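/- **Notation.** Let $\mathbb S^2\subset\mathbb R^3$ be the unit sphere and write $\boldsymbol e_\varphi=(\cos\varphi,\sin\varphi,0)^\top$. The arc transform $\mathcal A\colon C(\mathbb S^2)\to C(\mathrm{SO}(3)\times[0,\pi])$ (complex-valued functions) is $$\mathcal A f(Q,\psi)=\int_{-\psi}^{\psi} f(Q^{-1}\boldsymbol e_\varphi)\,\mathrm d\varphi .$$ For $n\in\mathbb N_0$ and $0\le k\le n$ let $$P_n^k(t)=\frac{(-1)^k}{2^n n!}(1-t^2)^{k/2}\frac{\mathrm d^{n+k}}{\mathrm dt^{n+k}}(t^2-1)^n,\qquad \widetilde P_n^k=\sqrt{\frac{2n+1}{4\pi}\frac{(n-k)!}{(n+k)!}}\;P_n^k,\qquad \widetilde P_n^{-k}=(-1)^k\widetilde P_n^k \qquad(t\in[-1,1]).$$ For $-n\le k\le n$ the spherical harmonic $Y_n^k\in C(\mathbb S^2)$ is given by $Y_n^k(\cos\varphi\sin\vartheta,\sin\varphi\sin\vartheta,\cos\vartheta)=\widetilde P_n^k(\cos\vartheta)\,e^{\mathrm ik\varphi}$. For $-n\le k,j\le n$ the Wigner D-function $D_n^{k,j}$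 on $\mathrm{SO}(3)$ is given in Euler angles $\alpha,\gamma\in[0,2\pi)$, $\beta\in[0,\pi]$ by $$D_n^{k,j}\bigl(R_3(\alpha)R_2(\beta)R_3(\gamma)\bigr)=e^{-\mathrm ik\alpha}\,d_n^{k,j}(\cos\beta)\,e^{-\mathrm ij\gamma},$$ $$R_3(\alpha)=\begin{pmatrix}\cos\alpha&-\sin\alpha&0\\ \sin\alpha&\cos\alpha&0\\0&0&1\end{pmatrix},\qquad R_2(\beta)=\begin{pmatrix}\cos\beta&0&\sin\beta\\0&1&0\\-\sin\beta&0&\cos\beta\end{pmatrix},$$ $$d_n^{k,j}(t)=\frac{(-1)^{n-j}}{2^n}\sqrt{\frac{(n+k)!\,(1-t)^{j-k}}{(n-j)!\,(n+j)!\,(n-k)!\,(1+t)^{j+k}}}\;\Bigl(\frac{\mathrm d}{\mathrm dt}\Bigr)^{n-k}\frac{(1+t)^{n+j}}{(1-t)^{-n+j}}\qquad(-1<t<1),$$ extended continuously to $t=\pm1$. For integers $m\ge 1$, $m!!=m(m-2)(m-4)\cdots$ with last factor $2$ or $1$, and $0!!=(-1)!!=1$. **Theorem.** Let $n\in\mathbb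 N_0$ and $k\in\{-n,\dots,n\}$. Then for all $Q\in\mathrm{SO}(3)$ and $\psi\in[0,\pi]$ $$\mathcal A Y_n^k(Q,\psi)=\sum_{j=-n}^{n}\widetilde P_n^j(0)\,D_n^{j,k}(Q)\,s_j(\psi),\qquad s_j(\psi)=\begin{cases}2\psi,&j=0,\\ \dfrac{2\sin(j\psi)}{j},&j\ne0,\end{cases}$$ and for every $j\in\{-n,\dots,n\}$ $$\widetilde P_n^j(0)=\begin{cases}(-1)^{\frac{n+j}2}\sqrt{\dfrac{2n+1}{4\pi}\,\dfrac{(n-j-1)!!\,(n+j-1)!!}{(n-j)!!\,(n+j)!!}},& n+j\text{ even},\\[2mm] 0,& n+j\text{ odd}.\end{cases}$$ -/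

import Mathlib

noncomputable section

namespace ArcTransform

/-- The unit sphere `𝕊²` in Euclidean three-space. -/
abbrev S2 : Type := Metric.sphere (0 : EuclideanSpace ℝ (Fin 3)) 1

/-- The rotation group `SO(3)`. -/
abbrev SO3 : Type := Matrix.specialOrthogonalGroup (Fin 3) ℝ

theorem mem_S2_iff (v : EuclideanSpace ℝ (Fin 3)) :
    v ∈ Metric.sphere (0 : EuclideanSpace ℝ (Fin 3)) 1 ↔
      v 0 ^ 2 + v 1 ^ 2 + v 2 ^ 2 = 1 := by
  rw [mem_sphere_zero_iff_norm, EuclideanSpace.norm_eq, Real.sqrt_eq_one]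
  simp [Fin.sum_univ_three]

theorem S2.sum_sq (ξ : S2) : ξ.1 0 ^ 2 + ξ.1 1 ^ 2 + ξ.1 2 ^ 2 = 1 :=
  (mem_S2_iff ξ.1).1 ξ.2

theorem SO3.transpose_mul (Q : SO3) : Q.1.transpose * Q.1 = 1 :=
  (Matrix.mem_orthogonalGroup_iff' (A := Q.1)).1
    (Matrix.mem_specialOrthogonalGroup_iff.1 Q.2).1

theorem SO3.det_eq_one (Q : SO3) : Q.1.det = 1 :=
  (Matrix.mem_specialOrthogonalGroup_iff.1 Q.2).2

/-- The action of a rotation on a point of the sphere, `Q ξ`. -/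
def rotate (Q : SO3) (ξ : S2) : S2 :=
  ⟨WithLp.toLp 2 (Q.1.mulVec ξ.1.ofLp), by
    have h := SO3.transpose_mul Q
    have hξ := S2.sum_sq ξ
    have e : ∀ i j, (Q.1.transpose * Q.1) i j = (1 : Matrix (Fin 3) (Fin 3) ℝ) i j :=
      fun i j => by rw [h]
    have e00 := e 0 0
    have e11 := e 1 1
    have e22 := e 2 2
    have e01 := e 0 1
    have e02 := e 0 2
    have e12 := e 1 2
    simp [Matrix.mul_apply, Fin.sum_univ_three] at e00 e11 e22 e01 e02 e12
    rw [mem_S2_iff]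
    simp only [Matrix.mulVec, dotProduct, Fin.sum_univ_three]
    linear_combination hξ + (ξ.1 0) ^ 2 * e00 + (ξ.1 1) ^ 2 * e11 + (ξ.1 2) ^ 2 * e22
      + 2 * ξ.1 0 * ξ.1 1 * e01 + 2 * ξ.1 0 * ξ.1 2 * e02 + 2 * ξ.1 1 * ξ.1 2 * e12⟩

/-- The point `(cos φ, sin φ, 0)` of the equator. -/
def equator (φ : ℝ) : S2 :=
  ⟨!₂[Real.cos φ, Real.sin φ, 0], by
    rw [mem_S2_iff]
    simp⟩

/-! ### The arc transform -/

theorem continuous_rotate : Continuous fun p : SO3 × S2 => rotate p.1 p.2 := by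
  unfold rotate
  fun_prop

theorem continuous_equator : Continuous equator := by
  refine Continuous.subtype_mk ((PiLp.continuous_toLp 2 _).comp ?_) _
  refine continuous_pi fun i => ?_
  fin_cases i <;> simp <;> fun_prop

theorem continuous_inv_SO3 : Continuous fun Q : SO3 => Q⁻¹ := by
  refine Continuous.subtype_mk (f := fun Q : SO3 => Q.1.transpose) ?_ _
  fun_prop

/-- The arc transform `𝒜 : C(𝕊²) → C(SO(3) × [0, π])`,
`𝒜 f (Q, ψ) = ∫_{-ψ}^{ψ} f (Q⁻¹ e_φ) dφ`. -/
def arcTransform (f : C(S2, ℂ)) : C(SO3 × Set.Icc (0 : ℝ) Real.pi, ℂ) where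
  toFun p := ∫ φ in (-(p.2 : ℝ))..(p.2 : ℝ), f (rotate p.1⁻¹ (equator φ))
  continuous_toFun := by
    have hc : Continuous (Function.uncurry
        fun (p : SO3 × Set.Icc (0 : ℝ) Real.pi) (φ : ℝ) => f (rotate p.1⁻¹ (equator φ))) := by
      have h : Continuous fun q : (SO3 × Set.Icc (0 : ℝ) Real.pi) × ℝ =>
          (q.1.1⁻¹, equator q.2) :=
        (continuous_inv_SO3.comp (continuous_fst.comp continuous_fst)).prodMk
          (continuous_equator.comp continuous_snd)
      exact f.continuous.comp (continuous_rotate.comp h)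
    have h1 := intervalIntegral.continuous_parametric_intervalIntegral_of_continuous
      (a₀ := 0) (μ := MeasureTheory.volume) hc
      (s := fun p => (p.2 : ℝ)) (by fun_prop)
    have h2 := intervalIntegral.continuous_parametric_intervalIntegral_of_continuous
      (a₀ := 0) (μ := MeasureTheory.volume) hc
      (s := fun p => -(p.2 : ℝ)) (by fun_prop)
    refine (h1.sub h2).congr fun p => ?_
    have hp : Continuous fun φ : ℝ => f (rotate p.1⁻¹ (equator φ)) :=
      hc.comp (continuous_const.prodMk continuous_id)
    exact intervalIntegral.integral_interval_sub_left
      (hp.intervalIntegrable _ _) (hp.intervalIntegrable _ _)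

/-! ### Associated Legendre functions and spherical harmonics -/

/-- The associated Legendre function of degree `n` and order `k ≥ 0`,
`P_n^k(t) = (-1)^k / (2^n n!) (1 - t²)^{k/2} (d/dt)^{n+k} (t² - 1)^n`, for `t ∈ [-1, 1]`. -/
def legendre (n k : ℕ) (t : ℝ) : ℝ :=
  (-1) ^ k / (2 ^ n * (n.factorial : ℝ)) * (1 - t ^ 2) ^ ((k : ℝ) / 2) *
    iteratedDeriv (n + k) (fun s : ℝ => (s ^ 2 - 1) ^ n) t

/-- The normalized associated Legendre function of degree `n` and order `k ≥ 0`
(with `k ≤ n`). -/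
def normLegendreNat (n k : ℕ) (t : ℝ) : ℝ :=
  Real.sqrt ((2 * n + 1) / (4 * Real.pi) * (((n - k).factorial : ℝ) / ((n + k).factorial : ℝ))) * legendre n k t

/-- The normalized associated Legendre function `P̃_n^k` of degree `n` and order
`k ∈ {-n, …, n}`, where `P̃_n^{-k} = (-1)^k P̃_n^k`. -/
def normLegendre (n : ℕ) (k : ℤ) (t : ℝ) : ℝ :=
  if 0 ≤ k then normLegendreNat n k.toNat t
  else (-1) ^ (-k).toNat * normLegendreNat n (-k).toNat t

/-- The point with spherical coordinates `(φ, ϑ)`. -/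
def sphPoint (φ ϑ : ℝ) : S2 :=
  ⟨!₂[Real.cos φ * Real.sin ϑ, Real.sin φ * Real.sin ϑ, Real.cos ϑ], by
    rw [mem_S2_iff]
    simp
    linear_combination (Real.sin ϑ) ^ 2 * Real.sin_sq_add_cos_sq φ
      + Real.sin_sq_add_cos_sq ϑ⟩

/-- The spherical harmonic as a function on the sphere: at `ξ = ξ(φ, ϑ)` it takes the value
`P̃_n^k(cos ϑ) e^{ikφ}`. Here `cos ϑ = ξ₃`, and `φ` is the argument of `ξ₁ + i ξ₂`
(`sphericalHarmonic_sphPoint` shows that any other azimuth gives the same value). -/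
def sphericalHarmonicFun (n : ℕ) (k : ℤ) (ξ : S2) : ℂ :=
  (normLegendre n k (ξ.1 2) : ℂ) *
    Complex.exp (Complex.I * k * (Complex.arg ⟨ξ.1 0, ξ.1 1⟩ : ℝ))

theorem normLegendreNat_eq (n m : ℕ) : ∃ g : ℝ → ℝ, Continuous g ∧
    ∀ t, normLegendreNat n m t = g t * (1 - t ^ 2) ^ ((m : ℝ) / 2) := by
  have hd : Continuous (iteratedDeriv (n + m) (fun s : ℝ => (s ^ 2 - 1) ^ n)) :=
    ContDiff.continuous_iteratedDeriv (n := (n + m : ℕ)) _ (by fun_prop) le_rfl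
  refine ⟨fun t => Real.sqrt ((2 * n + 1) / (4 * Real.pi) *
    (((n - m).factorial : ℝ) / ((n + m).factorial : ℝ))) * ((-1) ^ m /
    (2 ^ n * (n.factorial : ℝ)) * iteratedDeriv (n + m) (fun s : ℝ => (s ^ 2 - 1) ^ n) t),
    by fun_prop, fun t => ?_⟩
  unfold normLegendreNat legendre
  ring

theorem normLegendre_eq (n : ℕ) (k : ℤ) : ∃ g : ℝ → ℝ, Continuous g ∧
    ∀ t, normLegendre n k t = g t * (1 - t ^ 2) ^ ((k.natAbs : ℝ) / 2) := by
  obtain ⟨g, hg, h⟩ := normLegendreNat_eq n k.natAbs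
  by_cases hk : 0 ≤ k
  · refine ⟨g, hg, fun t => ?_⟩
    have e : k.toNat = k.natAbs := by omega
    rw [normLegendre, if_pos hk, e, h]
  · refine ⟨fun t => (-1) ^ (-k).toNat * g t, by fun_prop, fun t => ?_⟩
    have e : (-k).toNat = k.natAbs := by omega
    rw [normLegendre, if_neg hk, e, h]
    ring

theorem cexp_int_mul (k : ℤ) (x : ℝ) :
    Complex.exp (Complex.I * k * x) = Complex.exp (x * Complex.I) ^ k := by
  rw [← Complex.exp_int_mul]
  congr 1
  ring

theorem rpow_mul_cexp (z : ℂ) (k : ℤ) :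
    (((‖z‖ ^ 2) ^ ((k.natAbs : ℝ) / 2) : ℝ) : ℂ) *
      Complex.exp (Complex.I * k * (Complex.arg z : ℝ)) =
    if 0 ≤ k then z ^ k.natAbs else (starRingEnd ℂ z) ^ k.natAbs := by
  have hr : (‖z‖ ^ 2) ^ ((k.natAbs : ℝ) / 2) = ‖z‖ ^ k.natAbs := by
    rw [← Real.rpow_natCast, ← Real.rpow_mul (norm_nonneg z), ← Real.rpow_natCast]
    congr 1
    push_cast
    ring
  rw [hr]
  split_ifs with hk
  · have e : Complex.exp (Complex.I * k * (Complex.arg z : ℝ)) =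
        Complex.exp (Complex.arg z * Complex.I) ^ k.natAbs := by
      rw [← Complex.exp_nat_mul]
      congr 1
      have : (k : ℂ) = (k.natAbs : ℂ) := by
        rw [← Int.cast_natCast (R := ℂ) k.natAbs, Int.natAbs_of_nonneg hk]
      rw [this]
      ring
    rw [e, Complex.ofReal_pow, ← mul_pow, Complex.norm_mul_exp_arg_mul_I]
  · have hz : starRingEnd ℂ z = ‖z‖ * Complex.exp (-(Complex.arg z * Complex.I)) := by
      conv_lhs => rw [← Complex.norm_mul_exp_arg_mul_I z]
      rw [map_mul, Complex.conj_ofReal, ← Complex.exp_conj]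
      simp
    have e : Complex.exp (Complex.I * k * (Complex.arg z : ℝ)) =
        Complex.exp (-(Complex.arg z * Complex.I)) ^ k.natAbs := by
      rw [← Complex.exp_nat_mul]
      congr 1
      have : (k : ℂ) = -(k.natAbs : ℂ) := by
        have : k = -(k.natAbs : ℤ) := by omega
        exact_mod_cast congrArg (Int.cast : ℤ → ℂ) this
      rw [this]
      ring
    rw [e, Complex.ofReal_pow, ← mul_pow, hz]

theorem continuous_sphericalHarmonicFun (n : ℕ) (k : ℤ) :
    Continuous (sphericalHarmonicFun n k) := by
  obtain ⟨g, hg, h⟩ := normLegendre_eq n k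
  have e : sphericalHarmonicFun n k = fun ξ : S2 => (g (ξ.1 2) : ℂ) *
      (if 0 ≤ k then ((ξ.1 0 : ℂ) + ξ.1 1 * Complex.I) ^ k.natAbs
        else ((ξ.1 0 : ℂ) - ξ.1 1 * Complex.I) ^ k.natAbs) := by
    funext ξ
    have hn : 1 - ξ.1 2 ^ 2 = ‖(⟨ξ.1 0, ξ.1 1⟩ : ℂ)‖ ^ 2 := by
      rw [← Complex.normSq_eq_norm_sq, Complex.normSq_mk]
      linear_combination - S2.sum_sq ξ
    have h1 : (⟨ξ.1 0, ξ.1 1⟩ : ℂ) = (ξ.1 0 : ℂ) + ξ.1 1 * Complex.I :=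
      Complex.mk_eq_add_mul_I _ _
    have h2 : starRingEnd ℂ (⟨ξ.1 0, ξ.1 1⟩ : ℂ) = (ξ.1 0 : ℂ) - ξ.1 1 * Complex.I := by
      rw [h1]
      simp
      ring
    rw [sphericalHarmonicFun, h, hn, Complex.ofReal_mul, mul_assoc, rpow_mul_cexp, h2, h1]
  rw [e]
  split_ifs <;> fun_prop

/-- The spherical harmonic `Y_n^k ∈ C(𝕊²)`. -/
def sphericalHarmonic (n : ℕ) (k : ℤ) : C(S2, ℂ) :=
  ⟨sphericalHarmonicFun n k, continuous_sphericalHarmonicFun n k⟩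

theorem sphericalHarmonic_sphPoint (n : ℕ) (k : ℤ) (φ ϑ : ℝ)
    (hϑ : ϑ ∈ Set.Icc 0 Real.pi) :
    sphericalHarmonic n k (sphPoint φ ϑ) =
      (normLegendre n k (Real.cos ϑ) : ℂ) * Complex.exp (Complex.I * k * φ) := by
  have h0 : 0 ≤ Real.sin ϑ := Real.sin_nonneg_of_mem_Icc hϑ
  have hz : (⟨Real.cos φ * Real.sin ϑ, Real.sin φ * Real.sin ϑ⟩ : ℂ) =
      Real.sin ϑ * Complex.exp (φ * Complex.I) := by
    rw [Complex.mk_eq_add_mul_I, Complex.exp_mul_I]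
    push_cast
    ring
  change (normLegendre n k (Real.cos ϑ) : ℂ) * Complex.exp (Complex.I * k *
    (Complex.arg ⟨Real.cos φ * Real.sin ϑ, Real.sin φ * Real.sin ϑ⟩ : ℝ)) = _
  rcases h0.eq_or_lt with h0 | h0
  · by_cases hk : k = 0
    · simp [hk]
    · obtain ⟨g, -, h⟩ := normLegendre_eq n k
      have hc : 1 - Real.cos ϑ ^ 2 = 0 := by
        rw [← Real.sin_sq, ← h0]
        simp
      have : (k.natAbs : ℝ) / 2 ≠ 0 := by simpa using hk
      rw [h, hc, Real.zero_rpow this]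
      simp
  · rw [cexp_int_mul, cexp_int_mul]
    congr 2
    have hn : ‖(⟨Real.cos φ * Real.sin ϑ, Real.sin φ * Real.sin ϑ⟩ : ℂ)‖ = Real.sin ϑ := by
      rw [hz, norm_mul, Complex.norm_real, Real.norm_of_nonneg h0.le,
        Complex.norm_exp_ofReal_mul_I, mul_one]
    have := Complex.norm_mul_exp_arg_mul_I
      (⟨Real.cos φ * Real.sin ϑ, Real.sin φ * Real.sin ϑ⟩ : ℂ)
    rw [hn] at this
    conv_rhs at this => rw [hz]
    exact mul_left_cancel₀ (by exact_mod_cast h0.ne') this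

/-! ### Euler angles and Wigner D-functions -/

/-- The rotation `R₃(α)` of the angle `α` about the third axis. -/
def rot3 (α : ℝ) : Matrix (Fin 3) (Fin 3) ℝ :=
  !![Real.cos α, -Real.sin α, 0; Real.sin α, Real.cos α, 0; 0, 0, 1]

/-- The rotation `R₂(β)` of the angle `β` about the second axis. -/
def rot2 (β : ℝ) : Matrix (Fin 3) (Fin 3) ℝ :=
  !![Real.cos β, 0, Real.sin β; 0, 1, 0; -Real.sin β, 0, Real.cos β]

/-- `(α, β, γ)` are Euler angles (in the `zyz`-convention) of the rotation `Q`: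
`α, γ ∈ [0, 2π)`, `β ∈ [0, π]` and `Q = R₃(α) R₂(β) R₃(γ)`. -/
structure IsEulerAngles (Q : SO3) (α β γ : ℝ) : Prop where
  alpha_mem : α ∈ Set.Ico 0 (2 * Real.pi)
  beta_mem : β ∈ Set.Icc 0 Real.pi
  gamma_mem : γ ∈ Set.Ico 0 (2 * Real.pi)
  eq : Q.1 = rot3 α * rot2 β * rot3 γ

theorem exists_angle (x y r : ℝ) (hr : 0 ≤ r) (h : x ^ 2 + y ^ 2 = r ^ 2) :
    ∃ α ∈ Set.Ico 0 (2 * Real.pi), x = r * Real.cos α ∧ y = r * Real.sin α := by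
  have hn : ‖(⟨x, y⟩ : ℂ)‖ = r := by
    rw [← abs_of_nonneg hr, ← abs_of_nonneg (norm_nonneg _), ← sq_eq_sq_iff_abs_eq_abs,
      ← Complex.normSq_eq_norm_sq, Complex.normSq_mk]
    linarith
  have h1 := Complex.norm_mul_cos_arg (⟨x, y⟩ : ℂ)
  have h2 := Complex.norm_mul_sin_arg (⟨x, y⟩ : ℂ)
  rw [hn] at h1 h2
  refine ⟨toIcoMod Real.two_pi_pos 0 (Complex.arg ⟨x, y⟩), ?_, ?_, ?_⟩
  · simpa using toIcoMod_mem_Ico Real.two_pi_pos 0 (Complex.arg ⟨x, y⟩)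
  · rw [toIcoMod, zsmul_eq_mul, Real.cos_sub_int_mul_two_pi, h1]
  · rw [toIcoMod, zsmul_eq_mul, Real.sin_sub_int_mul_two_pi, h2]

theorem exists_isEulerAngles (Q : SO3) : ∃ p : ℝ × ℝ × ℝ, IsEulerAngles Q p.1 p.2.1 p.2.2 := by
  have hQ := SO3.transpose_mul Q
  have hdet := SO3.det_eq_one Q
  have e : ∀ i j, (Q.1.transpose * Q.1) i j = (1 : Matrix (Fin 3) (Fin 3) ℝ) i j :=
    fun i j => by rw [hQ]
  have e00 := e 0 0
  have e11 := e 1 1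
  have e22 := e 2 2
  have e01 := e 0 1
  have e02 := e 0 2
  have e12 := e 1 2
  simp [Matrix.mul_apply, Fin.sum_univ_three] at e00 e11 e22 e01 e02 e12
  have hadj : Q.1.adjugate = Q.1.transpose := by
    have h : Q.1.adjugate * Q.1 = 1 := by rw [Matrix.adjugate_mul, hdet, one_smul]
    have h' : Q.1 * Q.1.transpose = 1 := mul_eq_one_comm.1 hQ
    calc Q.1.adjugate = Q.1.adjugate * (Q.1 * Q.1.transpose) := by rw [h', mul_one]
      _ = Q.1.transpose := by rw [← mul_assoc, h, one_mul]
  have a : ∀ i j, Q.1.adjugate i j = Q.1 j i := fun i j => by rw [hadj]; rfl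
  have a00 := a 0 0
  have a01 := a 0 1
  have a02 := a 0 2
  have a10 := a 1 0
  have a11 := a 1 1
  have a12 := a 1 2
  simp [Matrix.adjugate_fin_three] at a00 a01 a02 a10 a11 a12
  set β := Real.arccos (Q.1 2 2) with hβ
  have hle : -1 ≤ Q.1 2 2 ∧ Q.1 2 2 ≤ 1 := by
    constructor <;> nlinarith [sq_nonneg (Q.1 0 2), sq_nonneg (Q.1 1 2)]
  have hc : Real.cos β = Q.1 2 2 := Real.cos_arccos hle.1 hle.2
  have hs : 0 ≤ Real.sin β :=
    Real.sin_nonneg_of_nonneg_of_le_pi (Real.arccos_nonneg _) (Real.arccos_le_pi _)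
  have hcs := Real.sin_sq_add_cos_sq β
  obtain ⟨α, hα, hx, hy⟩ := exists_angle (Q.1 0 2) (Q.1 1 2) (Real.sin β) hs (by
    rw [hc] at hcs
    linarith)
  have hα2 := Real.sin_sq_add_cos_sq α
  have hN12 : -Real.sin α * Q.1 0 2 + Real.cos α * Q.1 1 2 = 0 := by
    rw [hx, hy]
    ring
  have hQ' : Q.1 * Q.1.transpose = 1 := mul_eq_one_comm.1 hQ
  have f : ∀ i j, (Q.1 * Q.1.transpose) i j = (1 : Matrix (Fin 3) (Fin 3) ℝ) i j :=
    fun i j => by rw [hQ']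
  have f00 := f 0 0
  have f11 := f 1 1
  have f01 := f 0 1
  simp [Matrix.mul_apply, Fin.sum_univ_three] at f00 f11 f01
  have hM : (-Real.sin α * Q.1 0 1 + Real.cos α * Q.1 1 1) ^ 2 +
      (-Real.sin α * Q.1 0 0 + Real.cos α * Q.1 1 0) ^ 2 = 1 ^ 2 := by
    linear_combination (Real.sin α) ^ 2 * f00 + (Real.cos α) ^ 2 * f11
      - 2 * Real.sin α * Real.cos α * f01 + hα2
      - (-Real.sin α * Q.1 0 2 + Real.cos α * Q.1 1 2) * hN12
  obtain ⟨γ, hγ, hu, hv⟩ := exists_angle _ _ 1 zero_le_one hM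
  refine ⟨(α, β, γ), hα, ⟨Real.arccos_nonneg _, Real.arccos_le_pi _⟩, hγ, ?_⟩
  rw [one_mul] at hu hv
  have hN00 : Real.cos α * Q.1 0 0 + Real.sin α * Q.1 1 0 = Q.1 2 2 * Real.cos γ := by
    rw [← hu]
    linear_combination -Real.cos α * a00 - Real.sin α * a01 - Q.1 2 1 * hN12
  have hN01 : Real.cos α * Q.1 0 1 + Real.sin α * Q.1 1 1 = -(Q.1 2 2 * Real.sin γ) := by
    rw [← hv]
    linear_combination -Real.cos α * a10 - Real.sin α * a11 + Q.1 2 0 * hN12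
  ext i j
  fin_cases i <;> fin_cases j <;>
    simp [rot3, rot2, Matrix.mul_apply, Fin.sum_univ_three, hc]
  · linear_combination Real.cos α * hN00 - Real.sin α * hv - Q.1 0 0 * hα2
  · linear_combination Real.cos α * hN01 - Real.sin α * hu - Q.1 0 1 * hα2
  · linear_combination hx
  · linear_combination Real.sin α * hN00 + Real.cos α * hv - Q.1 1 0 * hα2
  · linear_combination Real.sin α * hN01 + Real.cos α * hu - Q.1 1 1 * hα2
  · linear_combination hy
  · rw [← hu]
    linear_combination -a02 + Q.1 0 1 * hy - Q.1 1 1 * hx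
  · rw [← hv]
    linear_combination -a12 - Q.1 0 0 * hy + Q.1 1 0 * hx

/-- The Wigner d-function `d_n^{k,j}(t)`, `k, j ∈ {-n, …, n}`, at an interior point
`t ∈ (-1, 1)`. -/
def wignerdFormula (n : ℕ) (k j : ℤ) (t : ℝ) : ℝ :=
  (-1) ^ ((n : ℤ) - j) / 2 ^ n *
    Real.sqrt (((n + k).toNat.factorial * (1 - t) ^ (j - k)) /
      ((n - j).toNat.factorial * (n + j).toNat.factorial * (n - k).toNat.factorial *
        (1 + t) ^ (j + k))) *
    iteratedDeriv ((n : ℤ) - k).toNat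
      (fun s : ℝ => (1 + s) ^ ((n : ℤ) + j) / (1 - s) ^ (-(n : ℤ) + j)) t

open scoped Classical in
/-- The Wigner d-function `d_n^{k,j}` on `[-1, 1]`: the explicit formula on `(-1, 1)`, extended
continuously to the endpoints, where some factors of the formula are singular. -/
def wignerd (n : ℕ) (k j : ℤ) (t : ℝ) : ℝ :=
  if t ∈ Set.Ioo (-1) 1 then wignerdFormula n k j t
  else Filter.limUnder (nhdsWithin t (Set.Ioo (-1) 1)) (wignerdFormula n k j)

/-- The rotational harmonic (Wigner D-function) `D_n^{k,j}` as a function of Euler angles. -/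
def wignerDEuler (n : ℕ) (k j : ℤ) (α β γ : ℝ) : ℂ :=
  Complex.exp (-(Complex.I * k * α)) * (wignerd n k j (Real.cos β) : ℂ) *
    Complex.exp (-(Complex.I * j * γ))

/-- The rotational harmonic (Wigner D-function) `D_n^{k,j}` on `SO(3)`: its value at
`Q = Q(α, β, γ)` is `e^{-ikα} d_n^{k,j}(cos β) e^{-ijγ}`. For the rotations that have several
triples of Euler angles, `wignerD_eq` shows that all of them give the same value. -/
def wignerD (n : ℕ) (k j : ℤ) (Q : SO3) : ℂ :=
  let p := (exists_isEulerAngles Q).choose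
  wignerDEuler n k j p.1 p.2.1 p.2.2

theorem iteratedDeriv_eval (P : Polynomial ℝ) (m : ℕ) (t : ℝ) :
    iteratedDeriv m (fun s => P.eval s) t = (Polynomial.derivative^[m] P).eval t := by
  induction m generalizing P with
  | zero => simp
  | succ m ih =>
    have : deriv (fun s => P.eval s) = fun s => P.derivative.eval s := by
      funext s
      simp
    rw [iteratedDeriv_succ', this, ih, Function.iterate_succ_apply]

theorem zpow_mul_eval_sq (p R : Polynomial ℝ) (z : ℤ) (hz : z ≠ 0)
    (hd : p ^ (-z).toNat ∣ R) : ∃ (l : ℕ) (q : Polynomial ℝ), l ≠ 0 ∧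
      ∀ t, 0 < p.eval t → p.eval t ^ z * R.eval t ^ 2 = p.eval t ^ l * q.eval t := by
  rcases hz.lt_or_gt with h | h
  · obtain ⟨q, rfl⟩ := hd
    obtain ⟨l, hl⟩ : ∃ l : ℕ, -z = l := ⟨_, (Int.toNat_of_nonneg (by omega)).symm⟩
    have hz' : z = -(l : ℤ) := by omega
    refine ⟨l, q ^ 2, by omega, fun t ht => ?_⟩
    rw [hl, hz', zpow_neg, zpow_natCast, Int.toNat_natCast]
    simp only [Polynomial.eval_mul, Polynomial.eval_pow]
    field_simp
  · refine ⟨z.toNat, R ^ 2, by omega, fun t ht => ?_⟩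
    rw [Polynomial.eval_pow, ← zpow_natCast (Polynomial.eval t p), Int.toNat_of_nonneg h.le]

theorem wignerd_pole (n : ℕ) (k j ε : ℤ) (hk : k ∈ Set.Icc (-(n : ℤ)) n)
    (hj : j ∈ Set.Icc (-(n : ℤ)) n) (hε : ε = 1 ∨ ε = -1) (h : j ≠ ε * k) :
    wignerd n k j ε = 0 := by
  rw [Set.mem_Icc] at hk hj
  obtain ⟨a, ha⟩ : ∃ a : ℕ, (n : ℤ) + j = a := ⟨_, (Int.toNat_of_nonneg (by omega)).symm⟩
  obtain ⟨b, hb⟩ : ∃ b : ℕ, (n : ℤ) - j = b := ⟨_, (Int.toNat_of_nonneg (by omega)).symm⟩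
  obtain ⟨m, hm⟩ : ∃ m : ℕ, (n : ℤ) - k = m := ⟨_, (Int.toNat_of_nonneg (by omega)).symm⟩
  obtain ⟨C, hC⟩ : ∃ C : ℝ, C = ((n + k).toNat.factorial : ℝ) /
    ((n - j).toNat.factorial * (n + j).toNat.factorial * (n - k).toNat.factorial) := ⟨_, rfl⟩
  have hC0 : 0 ≤ C := by rw [hC]; positivity
  let P : Polynomial ℝ := (1 + Polynomial.X) ^ a * (1 - Polynomial.X) ^ b
  let R : Polynomial ℝ := Polynomial.derivative^[m] P
  -- the square of the formula on the open interval
  have hsq : ∀ t ∈ Set.Ioo (-1 : ℝ) 1, wignerdFormula n k j t ^ 2 =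
      ((1 : ℝ) / 2 ^ n) ^ 2 * (C * ((1 - t) ^ (j - k) * (1 + t) ^ (-(j + k)))) *
        (R.eval t) ^ 2 := by
    intro t ht
    have h1 : 0 < 1 - t := by linarith [ht.2]
    have h2 : 0 < 1 + t := by linarith [ht.1]
    have hD : iteratedDeriv ((n : ℤ) - k).toNat
        (fun s : ℝ => (1 + s) ^ ((n : ℤ) + j) / (1 - s) ^ (-(n : ℤ) + j)) t = R.eval t := by
      have hf : (fun s : ℝ => (1 + s) ^ ((n : ℤ) + j) / (1 - s) ^ (-(n : ℤ) + j)) =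
          fun s => P.eval s := by
        funext s
        have e : -(n : ℤ) + j = -(b : ℤ) := by omega
        rw [e, ha, zpow_neg, zpow_natCast, zpow_natCast, div_inv_eq_mul]
        simp [P]
      rw [hf, hm, Int.toNat_natCast, iteratedDeriv_eval]
    have hs : ((-1 : ℝ) ^ ((n : ℤ) - j)) ^ 2 = 1 := by
      rw [hb, zpow_natCast, ← pow_mul, mul_comm, pow_mul]
      simp
    rw [wignerdFormula, hD, mul_pow, mul_pow, div_pow, hs, Real.sq_sqrt (by positivity), hC,
      zpow_neg]
    ring
  have hnb : (nhdsWithin (ε : ℝ) (Set.Ioo (-1) 1)).NeBot := by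
    rw [← mem_closure_iff_nhdsWithin_neBot, closure_Ioo (by norm_num)]
    rcases hε with rfl | rfl <;> norm_num
  have hnot : (ε : ℝ) ∉ Set.Ioo (-1 : ℝ) 1 := by
    rcases hε with rfl | rfl <;> norm_num
  suffices hmain : ∃ (g : ℝ → ℝ), ContinuousAt g ε ∧ g ε = 0 ∧
      ∀ t ∈ Set.Ioo (-1 : ℝ) 1, wignerdFormula n k j t ^ 2 = g t by
    obtain ⟨g, hg, hg0, hgt⟩ := hmain
    have ht : Filter.Tendsto (fun t => wignerdFormula n k j t ^ 2)
        (nhdsWithin (ε : ℝ) (Set.Ioo (-1) 1)) (nhds 0) := by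
      rw [← hg0]
      refine (hg.tendsto.mono_left nhdsWithin_le_nhds).congr' ?_
      filter_upwards [self_mem_nhdsWithin] with t ht using (hgt t ht).symm
    have ht' : Filter.Tendsto (wignerdFormula n k j)
        (nhdsWithin (ε : ℝ) (Set.Ioo (-1) 1)) (nhds 0) := by
      have := ht.sqrt
      simp only [Real.sqrt_sq_eq_abs, Real.sqrt_zero] at this
      exact (tendsto_zero_iff_abs_tendsto_zero _).2 this
    rw [wignerd, if_neg hnot]
    exact ht'.limUnder_eq
  rcases hε with rfl | rfl
  · have hdvd : (1 - Polynomial.X : Polynomial ℝ) ^ (-(j - k)).toNat ∣ R := by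
      have := Polynomial.pow_sub_dvd_iterate_derivative_of_pow_dvd m
        (Dvd.intro_left _ rfl : (1 - Polynomial.X : Polynomial ℝ) ^ b ∣ P)
      have e : (-(j - k)).toNat = b - m := by omega
      rwa [e]
    obtain ⟨l, q, hl, hq⟩ := zpow_mul_eval_sq _ R (j - k) (by omega) hdvd
    refine ⟨fun t => ((1 : ℝ) / 2 ^ n) ^ 2 * C * (1 + t) ^ (-(j + k)) *
      ((1 - t) ^ l * q.eval t), ?_, by simp [hl], fun t ht => ?_⟩
    · have : ContinuousAt (fun t : ℝ => (1 + t) ^ (-(j + k))) ((1 : ℤ) : ℝ) :=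
        ContinuousAt.zpow₀ (by fun_prop) _ (Or.inl (by norm_num))
      fun_prop
    · have := hq t (by simpa using ht.2)
      simp only [Polynomial.eval_sub, Polynomial.eval_one, Polynomial.eval_X] at this
      simp only [hsq t ht, ← this]
      ring
  · have hdvd : (1 + Polynomial.X : Polynomial ℝ) ^ (-(-(j + k))).toNat ∣ R := by
      have := Polynomial.pow_sub_dvd_iterate_derivative_of_pow_dvd m
        (Dvd.intro _ rfl : (1 + Polynomial.X : Polynomial ℝ) ^ a ∣ P)
      have e : (-(-(j + k))).toNat = a - m := by omega
      rwa [e]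
    obtain ⟨l, q, hl, hq⟩ := zpow_mul_eval_sq _ R (-(j + k)) (by omega) hdvd
    refine ⟨fun t => ((1 : ℝ) / 2 ^ n) ^ 2 * C * (1 - t) ^ (j - k) *
      ((1 + t) ^ l * q.eval t), ?_, by simp [hl], fun t ht => ?_⟩
    · have : ContinuousAt (fun t : ℝ => (1 - t) ^ (j - k)) ((-1 : ℤ) : ℝ) :=
        ContinuousAt.zpow₀ (by fun_prop) _ (Or.inl (by norm_num))
      fun_prop
    · have := hq t (by
        simp only [Polynomial.eval_add, Polynomial.eval_one, Polynomial.eval_X]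
        linarith [ht.1])
      simp only [Polynomial.eval_add, Polynomial.eval_one, Polynomial.eval_X] at this
      simp only [hsq t ht, ← this]
      ring

theorem wignerDEuler_eq_of_isEulerAngles (n : ℕ) (k j : ℤ) (hk : k ∈ Set.Icc (-(n : ℤ)) n)
    (hj : j ∈ Set.Icc (-(n : ℤ)) n) (Q : SO3) (α β γ α' β' γ' : ℝ)
    (h : IsEulerAngles Q α β γ) (h' : IsEulerAngles Q α' β' γ') :
    wignerDEuler n k j α β γ = wignerDEuler n k j α' β' γ' := by
  have hM := h.eq.symm.trans h'.eq
  have e : ∀ i l, (rot3 α * rot2 β * rot3 γ) i l = (rot3 α' * rot2 β' * rot3 γ') i l :=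
    fun i l => by rw [hM]
  have e22 := e 2 2
  have e02 := e 0 2
  have e12 := e 1 2
  have e20 := e 2 0
  have e21 := e 2 1
  have e11 := e 1 1
  have e01 := e 0 1
  simp [rot3, rot2, Matrix.mul_apply, Fin.sum_univ_three] at e22 e02 e12 e20 e21 e11 e01
  have hβ : β = β' := Real.injOn_cos h.beta_mem h'.beta_mem e22
  subst hβ
  -- the exponential factors as powers of points of the unit circle
  have hexp : ∀ (l : ℤ) (x : ℝ), Complex.exp (-(Complex.I * l * x)) =
      ((Real.cos x : ℂ) - Real.sin x * Complex.I) ^ l := by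
    intro l x
    have : (Real.cos x : ℂ) - Real.sin x * Complex.I = Complex.exp (-(x * Complex.I)) := by
      rw [← neg_mul, Complex.exp_mul_I, Complex.cos_neg, Complex.sin_neg, Complex.ofReal_cos,
        Complex.ofReal_sin]
      ring
    rw [this, ← Complex.exp_int_mul]
    congr 1
    ring
  have hs0 : 0 ≤ Real.sin β := Real.sin_nonneg_of_mem_Icc h.beta_mem
  rcases hs0.eq_or_lt with hs | hs
  · obtain ⟨ε, hε, hc⟩ : ∃ ε : ℤ, (ε = 1 ∨ ε = -1) ∧ Real.cos β = ε := by
      have h1 := Real.sin_sq_add_cos_sq β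
      rw [← hs] at h1
      have h2 : Real.cos β ^ 2 = 1 := by linarith
      have h3 : Real.cos β * Real.cos β = 1 := by rw [← sq, h2]
      rcases mul_self_eq_one_iff.1 h3 with h | h
      · exact ⟨1, Or.inl rfl, by simpa using h⟩
      · exact ⟨-1, Or.inr rfl, by simpa using h⟩
    by_cases hjk : j = ε * k
    · have hcomb : ∀ x y : ℝ, wignerDEuler n k j x β y =
          wignerd n k j (Real.cos β) *
            ((Real.cos (x + ε * y) : ℂ) - Real.sin (x + ε * y) * Complex.I) ^ k := by
        intro x y
        rw [← hexp, wignerDEuler, mul_right_comm, ← Complex.exp_add, mul_comm, hjk]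
        congr 2
        push_cast
        ring
      have h1 : Real.cos (α + ε * γ) = Real.cos (α' + ε * γ') ∧
          Real.sin (α + ε * γ) = Real.sin (α' + ε * γ') := by
        rcases hε with rfl | rfl
        · rw [hc] at e11 e01
          norm_num at e11 e01 ⊢
          rw [Real.cos_add, Real.cos_add, Real.sin_add, Real.sin_add]
          constructor <;> linarith
        · rw [hc] at e11 e01
          norm_num [← sub_eq_add_neg] at e11 e01 ⊢
          rw [Real.cos_sub, Real.cos_sub, Real.sin_sub, Real.sin_sub]
          constructor <;> linarith
      rw [hcomb, hcomb, h1.1, h1.2]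
    · simp [wignerDEuler, hc, wignerd_pole n k j ε hk hj hε hjk]
  · have c1 : Real.cos α = Real.cos α' := by
      apply mul_right_cancel₀ hs.ne'
      linarith
    have c2 : Real.sin α = Real.sin α' := by
      apply mul_right_cancel₀ hs.ne'
      linarith
    have c3 : Real.cos γ = Real.cos γ' := by
      apply mul_left_cancel₀ hs.ne'
      linarith
    have c4 : Real.sin γ = Real.sin γ' := by
      apply mul_left_cancel₀ hs.ne'
      linarith
    simp only [wignerDEuler, hexp, c1, c2, c3, c4]

theorem wignerD_eq (n : ℕ) (k j : ℤ) (hk : k ∈ Set.Icc (-(n : ℤ)) n)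
    (hj : j ∈ Set.Icc (-(n : ℤ)) n) (Q : SO3) (α β γ : ℝ) (h : IsEulerAngles Q α β γ) :
    wignerD n k j Q = Complex.exp (-(Complex.I * k * α)) *
      (wignerd n k j (Real.cos β) : ℂ) * Complex.exp (-(Complex.I * j * γ)) :=
  wignerDEuler_eq_of_isEulerAngles n k j hk hj Q _ _ _ _ _ _
    (exists_isEulerAngles Q).choose_spec h

/-! ### The remaining quantities of the formula -/

/-- `s_j(ψ)`, which is `2ψ` for `j = 0` and `2 sin(jψ) / j` for `j ≠ 0`. -/
def arcFactor (j : ℤ) (ψ : ℝ) : ℝ :=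
  if j = 0 then 2 * ψ else 2 * Real.sin (j * ψ) / j

/-- The double factorial `m!!` of an integer `m ≥ -1`, with `0!! = (-1)!! = 1`. -/
def dfact (m : ℤ) : ℕ := Nat.doubleFactorial m.toNat

end ArcTransform

end

noncomputable section

namespace ArcTransform

open Polynomial ComplexConjugate

/-! The spherical harmonics of degree n have a generating polynomial: with w = ξ₁ + iξ₂ and z = ξ₃,
the coefficient of X^(n+k) in (wX² + 2zX - w̄)^n is Y_n^k(ξ) up to an explicit constant
(`sphericalHarmonic_eq_coeff`). This is Rodrigues' formula with the derivatives read as Taylor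
coefficients.

Rotations act on this quadratic by substitution. Turning about the third axis scales X by a unit
complex number, so each coefficient only gains a phase (`coeff_quad_pow_unit_mul`). The inverse of
R₂(β) acts by the Möbius map X ↦ (cX + s)/(-sX + c) with c = cos(β/2), s = sin(β/2), after clearing
denominators (`coeff_quad_pow_rot2`). The matrix on coefficients is thus the symmetric power of a 2
× 2 rotation by the half angle, and `wignerd_mul_factRoot` identifies its entries with the Wigner
d-function after normalization.

For Q = R₃(α)R₂(β)R₃(γ) one has Q⁻¹e_φ = R₃(-γ)R₂(β)⁻¹e_(φ-α). Applying the three substitutions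
gives Y_n^k(Q⁻¹e_φ) = Σ_j P̃_n^j(0) D_n^{j,k}(Q) e^(ijφ) (`sphericalHarmonic_rotate_equator`), and
integrating in φ replaces the exponentials by s_j(ψ). At w = 1, z = 0 the quadratic is X² - 1, so
P̃_n^j(0) comes from the binomial theorem. -/

/-! ### Coefficients of powers under linear and Möbius substitutions -/

theorem coeff_pow_of_comp_C_mul_X {R : Type*} [CommRing R] {P Q : R[X]} {u c : R}
    (h : P.comp (C u * X) = C c * Q) (n m : ℕ) :
    (P ^ n).coeff m * u ^ m = c ^ n * (Q ^ n).coeff m := by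
  rw [← comp_C_mul_X_coeff, pow_comp, h, mul_pow, ← C_pow, coeff_C_mul]

theorem aeval_homogenize {R : Type*} [CommRing R] (p : R[X]) (N : ℕ) (A D : R[X]) :
    MvPolynomial.aeval ![A, D] (p.homogenize N) =
      ∑ m ∈ Finset.range (N + 1), C (p.coeff m) * (A ^ m * D ^ (N - m)) := by
  rw [homogenize, map_sum, ← Finset.Nat.sum_antidiagonal_eq_sum_range_succ
    (fun i j => C (p.coeff i) * (A ^ i * D ^ j))]
  refine Finset.sum_congr rfl fun kl _ => ?_
  rw [MvPolynomial.aeval_monomial, Finsupp.update_eq_add_single (by simp),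
    Finsupp.prod_add_index' (by simp) (by simp [pow_add])]
  simp [C_eq_algebraMap]

/-- Homogenization is multiplicative, so the form of degree 2n attached to p^n is the n-th power of
the quadratic form attached to p. The pair (A, D) stands for the Möbius substitution X ↦ A/D with
denominators cleared. Only a degree bound is used, so a may vanish. -/
theorem homogenize_quadratic_pow {R : Type*} [CommRing R] (a b c : R) (n : ℕ) (A D : R[X]) :
    (C a * A ^ 2 + C b * (A * D) + C c * D ^ 2) ^ n =
      ∑ m ∈ Finset.range (2 * n + 1),
        C (((C a * X ^ 2 + C b * X + C c) ^ n).coeff m) * (A ^ m * D ^ (2 * n - m)) := by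
  have h2 : (C a * X ^ 2 + C b * X + C c).natDegree ≤ 2 := natDegree_quadratic_le
  have h : ((C a * X ^ 2 + C b * X + C c) ^ n).homogenize (2 * n) =
      ((C a * X ^ 2 + C b * X + C c).homogenize 2) ^ n := by
    have := homogenize_finsetProd (s := Finset.range n)
      (p := fun _ => C a * X ^ 2 + C b * X + C c) (n := fun _ => 2) (fun _ _ => h2)
    simpa [mul_comm n 2] using this
  rw [← aeval_homogenize, h, map_pow]
  congr 1
  rw [aeval_homogenize]
  simp [Finset.sum_range_succ, coeff_X, coeff_C]
  ring

/-- Duality of the coefficients of `(aX + b)^p (dX + e)^(N - p)`, which are up to binomial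
coefficients the entries of the symmetric power of a `2 × 2` matrix. -/
theorem choose_mul_coeff_linear_pow (a b d e : ℝ) (N p m : ℕ) (hp : p ≤ N) :
    (N.choose p : ℝ) * ((C a * X + C b) ^ p * (C d * X + C e) ^ (N - p)).coeff m =
      N.choose m * ((C a + C d * X) ^ m * (C b + C e * X) ^ (N - m)).coeff (N - p) := by
  -- Generating function in a second variable y: (aX + b + y(dX + e))^N is expanded once in powers
  -- of y and once, after regrouping, in powers of X. The X^m coefficients agree for every real y,
  -- hence as polynomials in y.
  have key : ∑ i ∈ Finset.range (N + 1),
      C ((N.choose i : ℝ) * ((C a * X + C b) ^ i * (C d * X + C e) ^ (N - i)).coeff m) *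
        X ^ (N - i) = C (N.choose m : ℝ) * ((C a + C d * X) ^ m * (C b + C e * X) ^ (N - m)) := by
    refine Polynomial.funext fun y => ?_
    have h1 : (C a * X + C b + C y * (C d * X + C e)) ^ N =
        (C (a + y * d) * X + C (b + y * e)) ^ N := by
      simp only [C_add, C_mul]
      ring
    have h2 := congrArg (fun P => P.coeff m) h1
    rw [add_pow, add_pow] at h2
    simp only [finsetSum_coeff, eval_finsetSum] at h2 ⊢
    rw [Finset.sum_congr rfl (g := fun i => eval y
      (C ((N.choose i : ℝ) * ((C a * X + C b) ^ i * (C d * X + C e) ^ (N - i)).coeff m) *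
        X ^ (N - i)))] at h2
    · rw [h2]
      have : ∀ i, ((C (a + y * d) * X) ^ i * C (b + y * e) ^ (N - i) * (N.choose i : ℝ[X])).coeff m =
          if m = i then (a + y * d) ^ i * (b + y * e) ^ (N - i) * N.choose i else 0 := by
        intro i
        rw [show (C (a + y * d) * X) ^ i * C (b + y * e) ^ (N - i) * (N.choose i : ℝ[X]) =
          C ((a + y * d) ^ i * (b + y * e) ^ (N - i) * N.choose i) * X ^ i by
            simp only [C_mul, C_pow, map_natCast]; ring, coeff_C_mul_X_pow]
      simp only [this, Finset.sum_ite_eq]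
      simp only [eval_mul, eval_pow, eval_add, eval_C, eval_X]
      split_ifs with hm
      · ring
      · rw [Nat.choose_eq_zero_of_lt (by simpa using hm)]
        simp
    · intro i _
      rw [show (C a * X + C b) ^ i * (C y * (C d * X + C e)) ^ (N - i) * (N.choose i : ℝ[X]) =
          C (y ^ (N - i) * N.choose i) * ((C a * X + C b) ^ i * (C d * X + C e) ^ (N - i)) by
            simp only [C_mul, C_pow, map_natCast, mul_pow (C y)]; ring, coeff_C_mul]
      simp only [eval_mul, eval_pow, eval_C, eval_X]
      ring
  have h := congrArg (fun P => P.coeff (N - p)) key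
  simp only [finsetSum_coeff, coeff_C_mul] at h
  rw [← h, Finset.sum_eq_single p]
  · simp
  · intro i hi hip
    rw [Finset.mem_range] at hi
    rw [coeff_X_pow, if_neg (by omega), mul_zero]
  · intro h
    simp at h
    omega

/-- Taylor expansion at t. It turns the derivatives in the definitions of P_n^k and d_n^{k,j} into
coefficient extraction. -/
theorem iterate_derivative_eval_eq_coeff (P : ℝ[X]) (m : ℕ) (t : ℝ) :
    (derivative^[m] P).eval t = m.factorial * (P.comp (X + C t)).coeff m := by
  rw [← factorial_smul_hasseDeriv, ← taylor_apply, taylor_coeff]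
  simp

theorem continuous_coeff_mul {T R : Type*} [TopologicalSpace T] [CommRing R] [TopologicalSpace R]
    [IsTopologicalRing R] {P Q : T → R[X]} (hP : ∀ m, Continuous fun x => (P x).coeff m)
    (hQ : ∀ m, Continuous fun x => (Q x).coeff m) (m : ℕ) :
    Continuous fun x => (P x * Q x).coeff m := by
  simp only [coeff_mul]
  exact continuous_finsetSum _ fun i _ => (hP _).mul (hQ _)

theorem continuous_coeff_pow {T R : Type*} [TopologicalSpace T] [CommRing R] [TopologicalSpace R]
    [IsTopologicalRing R] {P : T → R[X]} (hP : ∀ m, Continuous fun x => (P x).coeff m) (n : ℕ) :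
    ∀ m, Continuous fun x => (P x ^ n).coeff m := by
  induction n with
  | zero => simpa using fun m => continuous_const
  | succ n ih => simpa only [pow_succ] using continuous_coeff_mul ih hP

/-! ### Spherical harmonics as coefficients of powers of a quadratic -/

/-- The quadratic polynomial `w X² + 2 z X - w̄`. The coefficients of its `n`-th power are, for
`w = ξ₁ + i ξ₂` and `z = ξ₃`, multiples of the spherical harmonics of degree `n` at `ξ`. -/
def quad (w z : ℂ) : ℂ[X] := C w * X ^ 2 + C (2 * z) * X + C (-conj w)

/-- Substituting vX and taking out a factor v replaces w by vw, because v⁻¹ = v̄. This is the effect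
of a rotation about the third axis. -/
theorem coeff_quad_pow_of_unit (v w z : ℂ) (hv : v * conj v = 1) (n m : ℕ) :
    v ^ n * (quad (v * w) z ^ n).coeff m = v ^ m * (quad w z ^ n).coeff m := by
  have h : (quad w z).comp (C v * X) = C v * quad (v * w) z := by
    have hC : C v * C (conj v) = (1 : ℂ[X]) := by rw [← C_mul, hv, C_1]
    simp only [quad, map_mul, map_neg, add_comp, mul_comp, neg_comp, pow_comp, C_comp, X_comp]
    linear_combination C (conj w) * hC
  rw [← coeff_pow_of_comp_C_mul_X h n m, mul_comm]

/-- The substitution X ↦ -1/X, homogenized as the pair (-1, X), sends the quadratic of (w, z) to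
minus that of (w̄, z) and reverses the order of the coefficients. It relates the orders k and -k. -/
theorem coeff_quad_pow_reverse (w z : ℂ) (n m : ℕ) (hm : m ≤ 2 * n) :
    (quad (conj w) z ^ n).coeff (2 * n - m) = (-1) ^ (n + m) * (quad w z ^ n).coeff m := by
  have h := homogenize_quadratic_pow w (2 * z) (-conj w) n (C (-1)) X
  have e : C w * C (-1) ^ 2 + C (2 * z) * (C (-1) * X) + C (-conj w) * X ^ 2 =
      C (-1) * quad (conj w) z := by
    simp only [quad, map_mul, map_neg, map_one, Complex.conj_conj]
    ring
  rw [e, mul_pow, ← C_pow] at h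
  have h' := congrArg (fun P => P.coeff (2 * n - m)) h
  simp only [finsetSum_coeff, ← C_pow, coeff_C_mul, coeff_X_pow] at h'
  rw [Finset.sum_eq_single m] at h'
  · rw [if_pos rfl, mul_one] at h'
    have h1 : ((-1 : ℂ) ^ n) * (-1) ^ n = 1 := by rw [← mul_pow]; simp
    rw [pow_add]
    change (-1) ^ n * (quad (conj w) z ^ n).coeff (2 * n - m) =
      (quad w z ^ n).coeff m * (-1) ^ m at h'
    linear_combination (-1) ^ n * h' - (quad (conj w) z ^ n).coeff (2 * n - m) * h1
  · intro i hi him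
    rw [Finset.mem_range] at hi
    rw [if_neg (by omega)]
    simp
  · intro h
    simp at h
    omega

theorem conj_coeff_quad_pow (w : ℂ) (z : ℝ) (n m : ℕ) :
    conj ((quad w z ^ n).coeff m) = (quad (conj w) z ^ n).coeff m := by
  have : (quad w z).map (starRingEnd ℂ) = quad (conj w) z := by
    have h2 : conj (2 : ℂ) = 2 := map_ofNat _ 2
    simp [quad, Polynomial.map_add, h2]
  rw [← this, ← Polynomial.map_pow, coeff_map]

theorem iteratedDeriv_sq_sub_one_pow (n m : ℕ) (t : ℝ) :
    iteratedDeriv m (fun s : ℝ => (s ^ 2 - 1) ^ n) t =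
      m.factorial * ((X ^ 2 + C (2 * t) * X + C (-(1 - t ^ 2))) ^ n : ℝ[X]).coeff m := by
  have e : (fun s : ℝ => (s ^ 2 - 1) ^ n) = fun s => ((X ^ 2 - 1) ^ n : ℝ[X]).eval s := by
    simp
  rw [e, iteratedDeriv_eval, iterate_derivative_eval_eq_coeff, pow_comp]
  congr 4
  simp only [sub_comp, pow_comp, X_comp, one_comp, map_mul, map_neg, map_sub, map_pow, map_one,
    map_ofNat]
  ring

/-- Since w w̄ = 1 - z², substituting wX into the shifted polynomial X² + 2zX - (1 - z²) gives w
times the quadratic of (w, z). -/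
theorem pow_mul_coeff_quad_pow (w : ℂ) (z : ℝ) (h : ‖w‖ ^ 2 = 1 - z ^ 2) (n k : ℕ) :
    w ^ k * (((X ^ 2 + C (2 * z) * X + C (-(1 - z ^ 2))) ^ n : ℝ[X]).coeff (n + k) : ℂ) =
      (quad w z ^ n).coeff (n + k) := by
  have hw : w * conj w = 1 - (z : ℂ) ^ 2 := by
    rw [Complex.mul_conj, Complex.normSq_eq_norm_sq, h]
    push_cast
    ring
  have hmap : (((X ^ 2 + C (2 * z) * X + C (-(1 - z ^ 2))) ^ n : ℝ[X]).coeff (n + k) : ℂ) =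
      ((X ^ 2 + C (2 * (z : ℂ)) * X + C (-(1 - (z : ℂ) ^ 2))) ^ n).coeff (n + k) := by
    rw [← Complex.ofRealHom_eq_coe, ← coeff_map, Polynomial.map_pow]
    simp [Polynomial.map_add]
  rw [hmap]
  -- At the poles the scaling by w cannot be undone. There both quadratics degenerate and the
  -- coefficients are computed directly: (2z)^n for k = 0, and 0 for k > 0.
  by_cases h0 : w = 0
  · subst h0
    have hz : 1 - (z : ℂ) ^ 2 = 0 := by simpa using hw.symm
    rcases Nat.eq_zero_or_pos k with rfl | hk
    · rw [hz]
      have e1 : X ^ 2 + C (2 * (z : ℂ)) * X + C (-0) = X * (X + C (2 * (z : ℂ))) := by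
        simp only [neg_zero, map_zero]
        ring
      have e2 : quad 0 z = X * C (2 * (z : ℂ)) := by
        simp [quad, mul_comm]
      have e3 : n + 0 = 0 + n := by omega
      rw [e1, e2, mul_pow, mul_pow, e3, coeff_X_pow_mul, coeff_X_pow_mul, ← C_pow, coeff_C_zero,
        coeff_zero_eq_eval_zero]
      simp
    · have e2 : quad 0 z ^ n = C ((2 * (z : ℂ)) ^ n) * X ^ n := by
        simp [quad, mul_pow]
      rw [zero_pow hk.ne', zero_mul, e2, coeff_C_mul, coeff_X_pow, if_neg (by omega), mul_zero]
  · have hc : (X ^ 2 + C (2 * (z : ℂ)) * X + C (-(1 - (z : ℂ) ^ 2))).comp (C w * X) =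
        C w * quad w z := by
      rw [← hw]
      simp only [quad, map_mul, map_neg, add_comp, mul_comp, neg_comp, pow_comp, C_comp, X_comp]
      ring
    have := coeff_pow_of_comp_C_mul_X hc n (n + k)
    refine mul_left_cancel₀ (pow_ne_zero n h0) ?_
    rw [← this]
    ring

/-- The normalization of `sphericalHarmonic` in terms of the coefficients of `quad`. -/
def harmonicConst (n : ℕ) : ℝ := Real.sqrt ((2 * n + 1) / (4 * Real.pi)) / (2 ^ n * n.factorial)

/-- The square root of `(n - k)! (n + k)!`. -/
def factRoot (n : ℕ) (k : ℤ) : ℝ :=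
  Real.sqrt (((n : ℤ) - k).toNat.factorial * ((n : ℤ) + k).toNat.factorial)

theorem factRoot_pos (n : ℕ) (k : ℤ) : 0 < factRoot n k := by
  unfold factRoot
  positivity

theorem factRoot_neg (n : ℕ) (k : ℤ) : factRoot n (-k) = factRoot n k := by
  unfold factRoot
  rw [sub_neg_eq_add, ← sub_eq_add_neg, mul_comm]

/-- The factor (1 - z²)^(k/2) joins the exponential to form w^k, and the (n+k)! from the Taylor
coefficient turns √((n-k)!/(n+k)!) into √((n-k)!(n+k)!), which is symmetric in ±k. -/
theorem normLegendreNat_mul_factor (n k : ℕ) (hk : k ≤ n) (w : ℂ) (z : ℝ)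
    (h : ‖w‖ ^ 2 = 1 - z ^ 2) :
    (normLegendreNat n k z : ℂ) * Complex.exp (Complex.I * k * (Complex.arg w : ℝ)) =
      harmonicConst n * (-1) ^ k * factRoot n k * (quad w z ^ n).coeff (n + k) := by
  have hp := rpow_mul_cexp w k
  rw [if_pos (by omega), Int.natAbs_natCast, h, Int.cast_natCast] at hp
  have hs : Real.sqrt ((2 * n + 1) / (4 * Real.pi) *
      (((n - k).factorial : ℝ) / ((n + k).factorial : ℝ))) * (n + k).factorial =
      Real.sqrt ((2 * n + 1) / (4 * Real.pi)) * factRoot n k := by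
    have e1 : ((n : ℤ) - k).toNat = n - k := by omega
    have e2 : ((n : ℤ) + k).toNat = n + k := by omega
    have hf : (0 : ℝ) < (n + k).factorial := by positivity
    rw [factRoot, e1, e2, Real.sqrt_mul (by positivity), mul_assoc]
    congr 1
    rw [← Real.sqrt_sq hf.le, ← Real.sqrt_mul (by positivity), Real.sqrt_sq hf.le]
    congr 1
    field_simp
  rw [normLegendreNat, legendre, iteratedDeriv_sq_sub_one_pow, ← pow_mul_coeff_quad_pow w z h,
    ← hp, harmonicConst]
  have hs' := congrArg (fun x : ℝ => (x : ℂ)) hs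
  simp only [Complex.ofReal_mul, Complex.ofReal_natCast] at hs'
  simp only [Complex.ofReal_mul, Complex.ofReal_div, Complex.ofReal_pow, Complex.ofReal_neg,
    Complex.ofReal_one, Complex.ofReal_natCast, Complex.ofReal_ofNat]
  generalize ((((X ^ 2 + C (2 * z) * X + C (-(1 - z ^ 2))) ^ n : ℝ[X]).coeff (n + k) : ℝ) : ℂ) = c
  generalize (((1 - z ^ 2) ^ ((k : ℝ) / 2) : ℝ) : ℂ) = r
  linear_combination (-1) ^ k / (2 ^ n * (n.factorial : ℂ)) * r * c *
    Complex.exp (Complex.I * k * (Complex.arg w : ℝ)) * hs'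

/-- Negative orders follow from positive ones by complex conjugation, which replaces w by w̄, and
reversal of the coefficients. The sign of the reversal is the one in P̃_n^{-k} = (-1)^k P̃_n^k. -/
theorem normLegendre_mul_exp_arg (n : ℕ) (k : ℤ) (hk : k ∈ Set.Icc (-(n : ℤ)) n) (w : ℂ) (z : ℝ)
    (h : ‖w‖ ^ 2 = 1 - z ^ 2) :
    (normLegendre n k z : ℂ) * Complex.exp (Complex.I * k * (Complex.arg w : ℝ)) =
      harmonicConst n * (-1) ^ k * factRoot n k *
        (quad w z ^ n).coeff ((n : ℤ) + k).toNat := by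
  rw [Set.mem_Icc] at hk
  by_cases h0 : 0 ≤ k
  · lift k to ℕ using h0
    rw [normLegendre, if_pos (by omega), Int.toNat_natCast, Int.cast_natCast,
      normLegendreNat_mul_factor n k (by omega) w z h, zpow_natCast]
    congr 2
  · obtain ⟨m, rfl⟩ : ∃ m : ℕ, k = -m := ⟨k.natAbs, by omega⟩
    have h1 := congrArg conj (normLegendreNat_mul_factor n m (by omega) w z h)
    simp only [map_mul, Complex.conj_ofReal, ← Complex.exp_conj, Complex.conj_I, map_natCast,
      map_pow, map_neg, map_one, conj_coeff_quad_pow] at h1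
    have e : ((n : ℤ) + -m).toNat = n - m := by omega
    have h2 := coeff_quad_pow_reverse w z n (n - m) (by omega)
    rw [show 2 * n - (n - m) = n + m by omega] at h2
    have h3 : ((-1 : ℂ) ^ (n + (n - m))) = (-1) ^ m := by
      rw [show n + (n - m) = 2 * (n - m) + m by omega, pow_add, pow_mul]
      simp
    have h4 : ((-1 : ℂ) ^ m) * (-1) ^ m = 1 := by rw [← mul_pow]; simp
    rw [normLegendre, if_neg h0, neg_neg, Int.toNat_natCast, e, factRoot_neg, zpow_neg,
      zpow_natCast]
    rw [h2, h3] at h1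
    have h5 : ((-1 : ℂ) ^ m)⁻¹ = (-1) ^ m := by
      rw [← inv_pow]
      norm_num
    have h6 : Complex.exp (Complex.I * ((-(m : ℤ) : ℤ) : ℂ) * (Complex.arg w : ℝ)) =
        Complex.exp (-Complex.I * m * (Complex.arg w : ℝ)) := by
      congr 1
      push_cast
      ring
    rw [h5, h6]
    push_cast
    linear_combination (-1) ^ m * h1 + (-1) ^ m * harmonicConst n * factRoot n m *
      (quad w z ^ n).coeff (n - m) * h4

/-- The complex number `ξ₁ + i ξ₂`. -/
def planar (ξ : S2) : ℂ := ⟨ξ.1 0, ξ.1 1⟩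

theorem sphericalHarmonic_eq_coeff (n : ℕ) (k : ℤ) (hk : k ∈ Set.Icc (-(n : ℤ)) n) (ξ : S2) :
    sphericalHarmonic n k ξ = harmonicConst n * (-1) ^ k * factRoot n k *
      (quad (planar ξ) (ξ.1 2 : ℝ) ^ n).coeff ((n : ℤ) + k).toNat := by
  refine normLegendre_mul_exp_arg n k hk (planar ξ) (ξ.1 2) ?_
  rw [← Complex.normSq_eq_norm_sq, planar, Complex.normSq_mk]
  linear_combination S2.sum_sq ξ

theorem normLegendre_zero_eq_coeff (n : ℕ) (j : ℤ) (hj : j ∈ Set.Icc (-(n : ℤ)) n) :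
    (normLegendre n j 0 : ℂ) = harmonicConst n * (-1) ^ j * factRoot n j *
      (quad 1 0 ^ n).coeff ((n : ℤ) + j).toNat := by
  have := normLegendre_mul_exp_arg n j hj 1 0 (by simp)
  simpa using this

/-! ### Wigner d-functions as entries of a symmetric power -/

/-- The coefficient of `X^{n+k}` in `(c X + s)^{n+j} (c - s X)^{n-j}`. -/
def halfAngleCoeff (n : ℕ) (j k : ℤ) (c s : ℝ) : ℝ :=
  ((C c * X + C s) ^ ((n : ℤ) + j).toNat * (C (-s) * X + C c) ^ ((n : ℤ) - j).toNat).coeff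
    ((n : ℤ) + k).toNat

theorem continuous_halfAngleCoeff (n : ℕ) (j k : ℤ) :
    Continuous fun x : ℝ × ℝ => halfAngleCoeff n j k x.1 x.2 := by
  have h : ∀ (a b : ℝ × ℝ → ℝ), Continuous a → Continuous b → ∀ m,
      Continuous fun x => (C (a x) * X + C (b x)).coeff m := by
    intro a b ha hb m
    simp only [coeff_add, coeff_C_mul, coeff_X, coeff_C]
    split_ifs <;> fun_prop
  exact continuous_coeff_mul
    (continuous_coeff_pow (h _ _ continuous_fst continuous_snd) _)
    (continuous_coeff_pow (h _ _ continuous_snd.neg continuous_fst) _) _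

theorem iteratedDeriv_wignerd (a b q : ℕ) (t : ℝ) :
    iteratedDeriv q (fun x : ℝ => (1 + x) ^ (a : ℤ) / (1 - x) ^ (-(b : ℤ))) t =
      q.factorial * ((X + C (1 + t)) ^ a * (-X + C (1 - t)) ^ b : ℝ[X]).coeff q := by
  have e : (fun x : ℝ => (1 + x) ^ (a : ℤ) / (1 - x) ^ (-(b : ℤ))) =
      fun x => ((1 + X) ^ a * (1 - X) ^ b : ℝ[X]).eval x := by
    funext x
    simp [zpow_neg]
  rw [e, iteratedDeriv_eval, iterate_derivative_eval_eq_coeff, mul_comp, pow_comp, pow_comp]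
  congr 5
  · simp only [add_comp, one_comp, X_comp, C_add, C_1]
    ring
  · simp only [sub_comp, one_comp, X_comp, C_sub, C_1]
    ring

/-- With t = c² - s² one has 1 + t = 2c² and 1 - t = 2s², so after X ↦ -2csX the factors X + 1 + t
and -X + 1 - t become 2c(c - sX) and 2s(s + cX). The derivative is therefore a coefficient `E` of a
product of powers of these linear forms, and the square root in the formula cancels the remaining
powers of c and s. The duality `choose_mul_coeff_linear_pow` exchanges the roles of j and k. -/
theorem wignerdFormula_mul_factRoot (n : ℕ) (j k : ℤ) (hj : j ∈ Set.Icc (-(n : ℤ)) n)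
    (hk : k ∈ Set.Icc (-(n : ℤ)) n) (c s : ℝ) (hc : 0 < c) (hs : 0 < s)
    (hcs : c ^ 2 + s ^ 2 = 1) :
    wignerdFormula n j k (c ^ 2 - s ^ 2) * factRoot n j =
      (-1) ^ (j + k) * factRoot n k * halfAngleCoeff n j k c s := by
  rw [Set.mem_Icc] at hj hk
  obtain ⟨p, hp⟩ : ∃ p : ℕ, (n : ℤ) + j = p := ⟨_, (Int.toNat_of_nonneg (by omega)).symm⟩
  obtain ⟨q, hq⟩ : ∃ q : ℕ, (n : ℤ) - j = q := ⟨_, (Int.toNat_of_nonneg (by omega)).symm⟩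
  obtain ⟨m, hm⟩ : ∃ m : ℕ, (n : ℤ) + k = m := ⟨_, (Int.toNat_of_nonneg (by omega)).symm⟩
  obtain ⟨r, hr⟩ : ∃ r : ℕ, (n : ℤ) - k = r := ⟨_, (Int.toNat_of_nonneg (by omega)).symm⟩
  have hpq : p + q = 2 * n := by omega
  have hmr : m + r = 2 * n := by omega
  set E : ℝ := ((C c + C (-s) * X) ^ m * (C s + C c * X) ^ r).coeff q with hE
  set F : ℝ := ((X + C (1 + (c ^ 2 - s ^ 2))) ^ m * (-X + C (1 - (c ^ 2 - s ^ 2))) ^ r : ℝ[X]).coeff q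
    with hF
  have hFE : F * (-(2 * c * s)) ^ q = (2 * c) ^ m * (2 * s) ^ r * E := by
    rw [hF, ← comp_C_mul_X_coeff, mul_comp, pow_comp, pow_comp]
    have h1 : (X + C (1 + (c ^ 2 - s ^ 2))).comp (C (-(2 * c * s)) * X) =
        C (2 * c) * (C c + C (-s) * X) := by
      rw [show 1 + (c ^ 2 - s ^ 2) = 2 * c * c by linear_combination -hcs]
      simp only [add_comp, X_comp, C_comp]
      simp only [C_mul, C_neg]
      ring
    have h2 : (-X + C (1 - (c ^ 2 - s ^ 2))).comp (C (-(2 * c * s)) * X) =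
        C (2 * s) * (C s + C c * X) := by
      rw [show 1 - (c ^ 2 - s ^ 2) = 2 * s * s by linear_combination -hcs]
      simp only [add_comp, neg_comp, X_comp, C_comp]
      simp only [C_mul, C_neg]
      ring
    rw [h1, h2, hE, ← coeff_C_mul]
    congr 1
    simp only [mul_pow, C_mul, C_pow]
    ring
  have hfj : factRoot n j ^ 2 = q.factorial * p.factorial := by
    rw [factRoot, Real.sq_sqrt (by positivity), hp, hq, Int.toNat_natCast, Int.toNat_natCast]
  have hfk : factRoot n k ^ 2 = r.factorial * m.factorial := by
    rw [factRoot, Real.sq_sqrt (by positivity), hm, hr, Int.toNat_natCast, Int.toNat_natCast]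
  have hj0 := factRoot_pos n j
  have hk0 := factRoot_pos n k
  -- The binomial coefficients in the duality are (2n)! divided by the squares of the two factorial
  -- roots.
  have hHE : factRoot n k ^ 2 * halfAngleCoeff n j k c s = factRoot n j ^ 2 * E := by
    have hd := choose_mul_coeff_linear_pow c s (-s) c (2 * n) p m (by omega)
    rw [show 2 * n - p = q by omega, show 2 * n - m = r by omega, ← hE] at hd
    rw [halfAngleCoeff, hp, hq, hm, Int.toNat_natCast, Int.toNat_natCast, Int.toNat_natCast]
    have c1 : ((2 * n).choose p : ℝ) * factRoot n j ^ 2 = (2 * n).factorial := by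
      rw [hfj, ← Nat.choose_mul_factorial_mul_factorial (show p ≤ 2 * n by omega),
        show 2 * n - p = q by omega]
      push_cast
      ring
    have c2 : ((2 * n).choose m : ℝ) * factRoot n k ^ 2 = (2 * n).factorial := by
      rw [hfk, ← Nat.choose_mul_factorial_mul_factorial (show m ≤ 2 * n by omega),
        show 2 * n - m = r by omega]
      push_cast
      ring
    generalize ((C c * X + C s) ^ p * (C (-s) * X + C c) ^ q).coeff m = H at hd ⊢
    have c3 : ((2 * n).factorial : ℝ) ≠ 0 := by positivity
    refine mul_left_cancel₀ c3 ?_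
    linear_combination factRoot n j ^ 2 * factRoot n k ^ 2 * hd - factRoot n k ^ 2 * H * c1
      + factRoot n j ^ 2 * E * c2
  have hsqrt : Real.sqrt ((p.factorial * (1 - (c ^ 2 - s ^ 2)) ^ (k - j)) /
      (r.factorial * m.factorial * q.factorial * (1 + (c ^ 2 - s ^ 2)) ^ (k + j))) * q.factorial *
        (factRoot n k * 2 ^ n * s ^ r * c ^ m) = factRoot n j * (2 * c * s) ^ q := by
    rw [show 1 + (c ^ 2 - s ^ 2) = 2 * c ^ 2 by linear_combination -hcs,
      show 1 - (c ^ 2 - s ^ 2) = 2 * s ^ 2 by linear_combination -hcs,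
      show k - j = (q : ℤ) - r by omega, show k + j = (m : ℤ) - q by omega,
      zpow_sub₀ (by positivity), zpow_sub₀ (by positivity)]
    simp only [zpow_natCast]
    have hq0 : (0 : ℝ) < q.factorial := by positivity
    have hr0 : (0 : ℝ) < r.factorial := by positivity
    have hm0 : (0 : ℝ) < m.factorial := by positivity
    rw [← Real.sqrt_sq (show (0 : ℝ) ≤ factRoot n j * (2 * c * s) ^ q by positivity), mul_assoc,
      ← Real.sqrt_sq (show (0 : ℝ) ≤ q.factorial * (factRoot n k * 2 ^ n * s ^ r * c ^ m) by
        positivity), ← Real.sqrt_mul (by positivity)]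
    congr 1
    have h2 : (2 : ℝ) ^ m * 2 ^ r = (2 ^ n) ^ 2 := by
      rw [← pow_add, hmr, ← pow_mul, mul_comm]
    simp only [mul_pow, hfj, hfk, ← h2]
    field_simp
    ring
  have hsign : (-1 : ℝ) ^ ((n : ℤ) - k) = (-1) ^ (j + k) * (-1) ^ q := by
    rw [← zpow_natCast (-1 : ℝ) q, ← zpow_add₀ (by norm_num), ← hq]
    rw [show (n : ℤ) - k = j + k + (n - j) + 2 * (-k) by ring, zpow_add₀ (by norm_num), zpow_mul]
    norm_num
  have hmain : wignerdFormula n j k (c ^ 2 - s ^ 2) * factRoot n k =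
      (-1) ^ (j + k) * factRoot n j * E := by
    have hexp : (-(n : ℤ) + k) = -(r : ℤ) := by omega
    rw [wignerdFormula, hp, hq, hm, hr, hexp]
    simp only [Int.toNat_natCast]
    rw [iteratedDeriv_wignerd, ← hF, ← hr, hsign]
    generalize Real.sqrt ((p.factorial * (1 - (c ^ 2 - s ^ 2)) ^ (k - j)) /
      (r.factorial * m.factorial * q.factorial * (1 + (c ^ 2 - s ^ 2)) ^ (k + j))) = A at hsqrt ⊢
    -- This product collects the factors multiplied onto the square root in `hsqrt` and onto the
    -- coefficient in `hFE`; it is nonzero as c and s are positive.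
    have hne : (2 : ℝ) ^ n * (s ^ r * c ^ m) * (2 * c * s) ^ q ≠ 0 := by positivity
    refine mul_right_cancel₀ hne ?_
    have h2 : (2 : ℝ) ^ m * 2 ^ r = 2 ^ n * 2 ^ n := by
      rw [← pow_add, hmr, ← pow_add, two_mul]
    rw [neg_pow, mul_pow 2 c m, mul_pow 2 s r] at hFE
    have hi : ((2 : ℝ) ^ n)⁻¹ * 2 ^ n = 1 := inv_mul_cancel₀ (by positivity)
    rw [div_eq_mul_inv]
    generalize ((2 : ℝ) ^ n)⁻¹ = i at hi ⊢
    linear_combination i * (-1) ^ (j + k) * (-1) ^ q * F * (2 * c * s) ^ q * hsqrt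
      + i * (-1) ^ (j + k) * factRoot n j * (2 * c * s) ^ q * hFE
      + i * (-1) ^ (j + k) * factRoot n j * (2 * c * s) ^ q * c ^ m * s ^ r * E * h2
      + (-1) ^ (j + k) * factRoot n j * (2 * c * s) ^ q * c ^ m * s ^ r * E * 2 ^ n * hi
  have h4 : factRoot n k ≠ 0 := hk0.ne'
  refine mul_right_cancel₀ h4 ?_
  linear_combination factRoot n j * hmain - (-1) ^ (j + k) * hHE

/-- The half-angle expression is continuous up to the endpoints, so it also computes the limits that
define the d-function at t = ±1. -/
theorem wignerd_mul_factRoot (n : ℕ) (j k : ℤ) (hj : j ∈ Set.Icc (-(n : ℤ)) n)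
    (hk : k ∈ Set.Icc (-(n : ℤ)) n) (β : ℝ) (hβ : β ∈ Set.Icc 0 Real.pi) :
    wignerd n j k (Real.cos β) * factRoot n j =
      (-1) ^ (j + k) * factRoot n k * halfAngleCoeff n j k (Real.cos (β / 2)) (Real.sin (β / 2)) := by
  -- Half angles written in terms of t = cos β; the real square root makes this a continuous
  -- function on the whole line.
  set h : ℝ → ℝ := fun t => (-1) ^ (j + k) * factRoot n k / factRoot n j *
    halfAngleCoeff n j k (Real.sqrt ((1 + t) / 2)) (Real.sqrt ((1 - t) / 2)) with hh
  have hf := (factRoot_pos n j).ne'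
  have hcont : Continuous h := by
    have := (continuous_halfAngleCoeff n j k).comp
      (show Continuous fun t : ℝ => (Real.sqrt ((1 + t) / 2), Real.sqrt ((1 - t) / 2)) by fun_prop)
    exact continuous_const.mul this
  have hin : ∀ t ∈ Set.Ioo (-1 : ℝ) 1, wignerdFormula n j k t = h t := by
    intro t ht
    have h1 : 0 < (1 + t) / 2 := by linarith [ht.1]
    have h2 : 0 < (1 - t) / 2 := by linarith [ht.2]
    have := wignerdFormula_mul_factRoot n j k hj hk _ _ (Real.sqrt_pos.2 h1) (Real.sqrt_pos.2 h2)
      (by rw [Real.sq_sqrt h1.le, Real.sq_sqrt h2.le]; ring)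
    rw [Real.sq_sqrt h1.le, Real.sq_sqrt h2.le, show (1 + t) / 2 - (1 - t) / 2 = t by ring] at this
    rw [hh]
    field_simp
    linear_combination this
  have heq : wignerd n j k (Real.cos β) = h (Real.cos β) := by
    by_cases ht : Real.cos β ∈ Set.Ioo (-1 : ℝ) 1
    · rw [wignerd, if_pos ht, hin _ ht]
    · rw [wignerd, if_neg ht]
      have : (nhdsWithin (Real.cos β) (Set.Ioo (-1) 1)).NeBot := by
        rw [← mem_closure_iff_nhdsWithin_neBot, closure_Ioo (by norm_num)]
        exact ⟨Real.neg_one_le_cos β, Real.cos_le_one β⟩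
      refine Filter.Tendsto.limUnder_eq ?_
      refine (hcont.continuousAt.tendsto.mono_left nhdsWithin_le_nhds).congr' ?_
      filter_upwards [self_mem_nhdsWithin] with t ht using (hin t ht).symm
  have hpi := Real.pi_pos
  rw [heq, hh, Real.cos_half (by linarith [hβ.1]) hβ.2, Real.sin_half_eq_sqrt hβ.1 (by linarith [hβ.2])]
  field_simp

/-! ### Rotations acting on the generating quadratic -/

theorem coeff_quad_pow_unit_mul (v w z : ℂ) (hv : v * conj v = 1) (n : ℕ) (k : ℤ)
    (hk : k ∈ Set.Icc (-(n : ℤ)) n) :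
    (quad (v * w) z ^ n).coeff ((n : ℤ) + k).toNat =
      v ^ k * (quad w z ^ n).coeff ((n : ℤ) + k).toNat := by
  rw [Set.mem_Icc] at hk
  have hv0 : v ≠ 0 := left_ne_zero_of_mul_eq_one hv
  have h := coeff_quad_pow_of_unit v w z hv n ((n : ℤ) + k).toNat
  have e : v ^ ((n : ℤ) + k).toNat = v ^ n * v ^ k := by
    rw [← zpow_natCast, Int.toNat_of_nonneg (by omega), zpow_add₀ hv0, zpow_natCast]
  rw [e, mul_assoc] at h
  exact mul_left_cancel₀ (pow_ne_zero n hv0) h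

/-- For c = cos(β/2), s = sin(β/2), the new arguments are the coordinates of R₂(β)⁻¹(x, y, z). The
Möbius substitution produces exactly this rotated quadratic; c² + s² = 1 is needed only for the
terms in y. -/
theorem coeff_quad_pow_rot2 (x y z c s : ℝ) (hcs : c ^ 2 + s ^ 2 = 1) (n : ℕ) (k : ℤ) :
    (quad ⟨(c ^ 2 - s ^ 2) * x - 2 * c * s * z, y⟩
        ((2 * c * s * x + (c ^ 2 - s ^ 2) * z : ℝ) : ℂ) ^ n).coeff ((n : ℤ) + k).toNat =
      ∑ j ∈ Finset.Icc (-(n : ℤ)) n,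
        (quad ⟨x, y⟩ z ^ n).coeff ((n : ℤ) + j).toNat * (halfAngleCoeff n j k c s : ℂ) := by
  have h := homogenize_quadratic_pow (⟨x, y⟩ : ℂ) (2 * (z : ℂ)) (-conj (⟨x, y⟩ : ℂ)) n
    (C (c : ℂ) * X + C (s : ℂ)) (C (-(s : ℂ)) * X + C (c : ℂ))
  have e : C (⟨x, y⟩ : ℂ) * (C (c : ℂ) * X + C (s : ℂ)) ^ 2 +
      C (2 * (z : ℂ)) * ((C (c : ℂ) * X + C (s : ℂ)) * (C (-(s : ℂ)) * X + C (c : ℂ))) +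
      C (-conj (⟨x, y⟩ : ℂ)) * (C (-(s : ℂ)) * X + C (c : ℂ)) ^ 2 =
      quad ⟨(c ^ 2 - s ^ 2) * x - 2 * c * s * z, y⟩
        ((2 * c * s * x + (c ^ 2 - s ^ 2) * z : ℝ) : ℂ) := by
    have hC : C (c : ℂ) ^ 2 + C (s : ℂ) ^ 2 = (1 : ℂ[X]) := by
      rw [← C_pow, ← C_pow, ← C_add, ← C_1]
      congr 1
      exact_mod_cast hcs
    have hx : ∀ a b : ℝ, conj (⟨a, b⟩ : ℂ) = a - b * Complex.I := by
      intro a b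
      apply Complex.ext <;> simp
    have h2 : (C 2 : ℂ[X]) = 2 := map_ofNat C 2
    rw [quad, hx, hx, Complex.mk_eq_add_mul_I, Complex.mk_eq_add_mul_I]
    push_cast
    simp only [C_add, C_sub, C_mul, C_neg, C_pow, h2]
    linear_combination (C (y : ℂ) * C Complex.I * X ^ 2 + C (y : ℂ) * C Complex.I) * hC
  rw [e] at h
  rw [h, finsetSum_coeff]
  symm
  -- The exponent i in 0, …, 2n corresponds to the order j = i - n.
  refine Finset.sum_nbij' (fun j => ((n : ℤ) + j).toNat) (fun i => (i : ℤ) - n) ?_ ?_ ?_ ?_ ?_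
  · intro j hj
    rw [Finset.mem_Icc] at hj
    rw [Finset.mem_range]
    omega
  · intro i hi
    rw [Finset.mem_range] at hi
    rw [Finset.mem_Icc]
    omega
  · intro j hj
    rw [Finset.mem_Icc] at hj
    omega
  · intro i hi
    omega
  · intro j hj
    rw [Finset.mem_Icc] at hj
    rw [coeff_C_mul, halfAngleCoeff, show 2 * n - ((n : ℤ) + j).toNat = ((n : ℤ) - j).toNat by omega]
    have hm : (C (c : ℂ) * X + C (s : ℂ)) ^ ((n : ℤ) + j).toNat *
        (C (-(s : ℂ)) * X + C (c : ℂ)) ^ ((n : ℤ) - j).toNat =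
        ((C c * X + C s) ^ ((n : ℤ) + j).toNat *
          (C (-s) * X + C c) ^ ((n : ℤ) - j).toNat).map Complex.ofRealHom := by
      simp [Polynomial.map_mul, Polynomial.map_pow, Polynomial.map_add]
    rw [hm, coeff_map]
    rfl

theorem exp_mul_I_mul_conj (x : ℝ) :
    Complex.exp (x * Complex.I) * conj (Complex.exp (x * Complex.I)) = 1 := by
  rw [Complex.mul_conj, Complex.normSq_eq_norm_sq, Complex.norm_exp_ofReal_mul_I]
  simp

/-- The Euler factors act one at a time: γ gives the phase e^(-ikγ), β the half-angle matrix, and α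
shifts the equatorial angle to φ - α, which gives e^(ij(φ-α)) times the coefficient at the base
point (1, 0, 0). -/
theorem sphericalHarmonic_rotate_equator (n : ℕ) (k : ℤ) (hk : k ∈ Set.Icc (-(n : ℤ)) n)
    (Q : SO3) (φ : ℝ) :
    sphericalHarmonic n k (rotate Q⁻¹ (equator φ)) =
      ∑ j ∈ Finset.Icc (-(n : ℤ)) n,
        (normLegendre n j 0 : ℂ) * wignerD n j k Q * Complex.exp (Complex.I * j * φ) := by
  obtain ⟨⟨α, β, γ⟩, hQ⟩ := exists_isEulerAngles Q
  simp only at hQ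
  set c := Real.cos (β / 2) with hc
  set s := Real.sin (β / 2) with hs
  have hcs : c ^ 2 + s ^ 2 = 1 := Real.cos_sq_add_sin_sq _
  have hcos : Real.cos β = c ^ 2 - s ^ 2 := by
    rw [hc, hs, ← Real.cos_two_mul', mul_div_cancel₀ _ two_ne_zero]
  have hsin : Real.sin β = 2 * c * s := by
    rw [hc, hs, mul_right_comm, ← Real.sin_two_mul, mul_div_cancel₀ _ two_ne_zero]
  have hinv : (Q⁻¹).1 = (rot3 α * rot2 β * rot3 γ).transpose := by
    rw [← hQ.eq]
    rfl
  -- The vanishing terms with 0 here and in `hw`, and the factor 1 in `hu`, keep the shape required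
  -- by `coeff_quad_pow_rot2` (third coordinate 0) and `coeff_quad_pow_unit_mul`.
  have hz : (rotate Q⁻¹ (equator φ)).1 2 =
      2 * c * s * Real.cos (φ - α) + (c ^ 2 - s ^ 2) * 0 := by
    rw [← hsin, Real.cos_sub]
    simp [rotate, hinv, equator, Matrix.mulVec, dotProduct, Fin.sum_univ_three, rot3, rot2]
    ring
  have hw : planar (rotate Q⁻¹ (equator φ)) = Complex.exp ((-γ : ℝ) * Complex.I) *
      ⟨(c ^ 2 - s ^ 2) * Real.cos (φ - α) - 2 * c * s * 0, Real.sin (φ - α)⟩ := by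
    rw [← hsin, ← hcos, Complex.exp_mul_I, ← Complex.ofReal_cos, ← Complex.ofReal_sin,
      Real.cos_neg, Real.sin_neg, Real.cos_sub, Real.sin_sub]
    apply Complex.ext <;>
    · simp [planar, rotate, hinv, equator, Matrix.mulVec, dotProduct, Fin.sum_univ_three, rot3,
        rot2, -Complex.ofReal_cos, -Complex.ofReal_sin]
      ring
  have hu : (⟨Real.cos (φ - α), Real.sin (φ - α)⟩ : ℂ) =
      Complex.exp ((φ - α : ℝ) * Complex.I) * 1 := by
    rw [Complex.exp_mul_I, ← Complex.ofReal_cos, ← Complex.ofReal_sin, mul_one,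
      Complex.mk_eq_add_mul_I]
  rw [sphericalHarmonic_eq_coeff n k hk, hw, hz,
    coeff_quad_pow_unit_mul _ _ _ (exp_mul_I_mul_conj _) n k hk,
    coeff_quad_pow_rot2 _ _ _ _ _ hcs, Finset.mul_sum, Finset.mul_sum]
  refine Finset.sum_congr rfl fun j hj => ?_
  rw [Finset.mem_Icc, ← Set.mem_Icc] at hj
  have hd := congrArg (fun x : ℝ => (x : ℂ)) (wignerd_mul_factRoot n j k hj hk β hQ.beta_mem)
  simp only [Complex.ofReal_mul, ← hc, ← hs, Complex.ofReal_zpow, Complex.ofReal_neg,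
    Complex.ofReal_one] at hd
  rw [zpow_add₀ (by norm_num)] at hd
  -- The sign (-1)^j in P̃_n^j(0) cancels part of the sign (-1)^(j+k) of the d-function, leaving the
  -- (-1)^k of Y_n^k.
  have h1 : (-1 : ℂ) ^ j * (-1) ^ j = 1 := by rw [← mul_zpow]; simp
  rw [hu, coeff_quad_pow_unit_mul _ _ _ (exp_mul_I_mul_conj _) n j hj,
    normLegendre_zero_eq_coeff n j hj, wignerD_eq n j k hj hk Q α β γ hQ, ← cexp_int_mul,
    ← cexp_int_mul]
  have h2 : Complex.exp (Complex.I * j * (φ - α : ℝ)) =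
      Complex.exp (Complex.I * j * φ) * Complex.exp (-(Complex.I * j * α)) := by
    rw [← Complex.exp_add]
    congr 1
    push_cast
    ring
  have h3 : Complex.exp (Complex.I * k * (-γ : ℝ)) = Complex.exp (-(Complex.I * k * γ)) := by
    congr 1
    push_cast
    ring
  rw [h2, h3, Complex.ofReal_zero]
  generalize (quad 1 0 ^ n).coeff ((n : ℤ) + j).toNat = q
  generalize Complex.exp (Complex.I * j * φ) = a at *
  generalize Complex.exp (-(Complex.I * j * α)) = b at *
  generalize Complex.exp (-(Complex.I * k * γ)) = d at *
  generalize (halfAngleCoeff n j k c s : ℂ) = H at *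
  linear_combination -(harmonicConst n * (-1) ^ j * q * a * b * d) * hd
    - (harmonicConst n * q * a * b * d * (-1) ^ k * factRoot n k * H) * h1

/-! ### Integration over the arc -/

theorem integral_exp_eq_arcFactor (j : ℤ) (ψ : ℝ) :
    ∫ φ in (-ψ)..ψ, Complex.exp (Complex.I * j * φ) = arcFactor j ψ := by
  rw [arcFactor]
  split_ifs with hj
  · subst hj
    simp
    ring
  · have hj' : (j : ℂ) ≠ 0 := by exact_mod_cast hj
    rw [integral_exp_mul_complex (mul_ne_zero Complex.I_ne_zero hj')]
    push_cast
    rw [Complex.sin]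
    have e1 : Complex.I * j * (ψ : ℂ) = j * ψ * Complex.I := by ring
    have e2 : Complex.I * j * (-ψ : ℂ) = -(j * ψ) * Complex.I := by ring
    rw [e1, e2]
    field_simp
    linear_combination (Complex.exp (j * ψ * Complex.I) - Complex.exp (-(j * ψ * Complex.I))) *
      Complex.I_sq

theorem arcTransform_sphericalHarmonic (n : ℕ) (k : ℤ) (hk : k ∈ Set.Icc (-(n : ℤ)) n)
    (Q : SO3) (ψ : Set.Icc (0 : ℝ) Real.pi) :
    arcTransform (sphericalHarmonic n k) (Q, ψ) =
      ∑ j ∈ Finset.Icc (-(n : ℤ)) n,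
        (normLegendre n j 0 : ℂ) * wignerD n j k Q * (arcFactor j ψ : ℂ) := by
  change ∫ φ in (-(ψ : ℝ))..(ψ : ℝ), sphericalHarmonic n k (rotate Q⁻¹ (equator φ)) = _
  simp only [sphericalHarmonic_rotate_equator n k hk]
  rw [intervalIntegral.integral_finsetSum]
  · refine Finset.sum_congr rfl fun j _ => ?_
    rw [intervalIntegral.integral_const_mul, integral_exp_eq_arcFactor]
  · intro j _
    exact Continuous.intervalIntegrable (by fun_prop) _ _

/-! ### Values of the Legendre functions at 0 -/

/-- The quadratic is X² - 1, that is, X - 1 evaluated at X², so only even exponents survive and the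
binomial theorem gives the rest. -/
theorem coeff_quad_one_zero_pow (n i : ℕ) :
    (quad 1 0 ^ n).coeff i =
      if Even i then (-1) ^ (n - i / 2) * (n.choose (i / 2) : ℂ) else 0 := by
  have e : quad 1 0 = expand ℂ 2 (X + C (-1)) := by
    simp [quad]
  rw [e, ← map_pow, coeff_expand two_pos, coeff_X_add_C_pow]
  simp only [even_iff_two_dvd]

theorem normLegendre_zero_of_odd (n : ℕ) (j : ℤ) (hj : j ∈ Set.Icc (-(n : ℤ)) n)
    (h : Odd ((n : ℤ) + j)) : normLegendre n j 0 = 0 := by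
  rw [Set.mem_Icc] at hj
  obtain ⟨i, hi⟩ : ∃ i : ℕ, (n : ℤ) + j = i := ⟨_, (Int.toNat_of_nonneg (by omega)).symm⟩
  have h1 := normLegendre_zero_eq_coeff n j hj
  rw [hi] at h
  have h' : ¬ Even i := Nat.not_even_iff_odd.2 (by exact_mod_cast h)
  rw [hi, Int.toNat_natCast, coeff_quad_one_zero_pow, if_neg h', mul_zero] at h1
  exact_mod_cast h1

theorem dfact_two_mul (m : ℕ) : dfact (2 * m) = 2 ^ m * m.factorial := by
  rw [dfact, ← Nat.doubleFactorial_two_mul]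
  congr 1

theorem dfact_mul_dfact (m : ℕ) :
    dfact (2 * m - 1) * dfact (2 * m) = (2 * m).factorial := by
  cases m with
  -- Here (-1)!! = 1 enters: the argument -1 is truncated to 0.
  | zero => rfl
  | succ m =>
    rw [dfact, dfact, show (2 * ((m + 1 : ℕ) : ℤ) - 1).toNat = 2 * m + 1 by omega,
      show (2 * ((m + 1 : ℕ) : ℤ)).toNat = 2 * m + 1 + 1 by omega,
      show 2 * (m + 1) = 2 * m + 1 + 1 by ring, Nat.factorial_eq_mul_doubleFactorial, mul_comm]

/-- With n + j = 2m and n - j = 2r the coefficient is (-1)^r C(n, m). Since C(n, m)/(2^n n!) =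
1/((2m)!!(2r)!!) and (2m)! = (2m-1)!!(2m)!!, multiplying by √((2m)!(2r)!) leaves the root of the
double factorial quotient. The sign is (-1)^(j+r) = (-1)^m. -/
theorem normLegendre_zero_of_even (n : ℕ) (j : ℤ) (hj : j ∈ Set.Icc (-(n : ℤ)) n)
    (h : Even ((n : ℤ) + j)) :
    normLegendre n j 0 = (-1) ^ (((n : ℤ) + j) / 2) *
      Real.sqrt ((2 * n + 1) / (4 * Real.pi) *
        ((dfact (n - j - 1) * dfact (n + j - 1)) / (dfact (n - j) * dfact (n + j)))) := by
  rw [Set.mem_Icc] at hj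
  obtain ⟨i, hi⟩ := h
  obtain ⟨m, rfl⟩ : ∃ m : ℕ, i = m := ⟨_, (Int.toNat_of_nonneg (by omega)).symm⟩
  obtain ⟨r, hr⟩ : ∃ r : ℕ, (n : ℤ) - m = r := ⟨_, (Int.toNat_of_nonneg (by omega)).symm⟩
  have hp : (n : ℤ) + j = 2 * m := by omega
  have hq : (n : ℤ) - j = 2 * r := by omega
  have hmr : n = m + r := by omega
  have h1 := normLegendre_zero_eq_coeff n j hj
  rw [hp, show (2 * (m : ℤ)).toNat = 2 * m by omega, coeff_quad_one_zero_pow,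
    if_pos (even_two_mul m), Nat.mul_div_cancel_left _ two_pos, show n - m = r by omega] at h1
  have h2 : normLegendre n j 0 =
      harmonicConst n * (-1) ^ j * factRoot n j * ((-1) ^ r * n.choose m) := by
    rw [← Complex.ofReal_inj, h1]
    push_cast
    rfl
  have hsign : (-1 : ℝ) ^ j * (-1) ^ r = (-1) ^ m := by
    rw [← zpow_natCast (-1 : ℝ) r, ← zpow_natCast (-1 : ℝ) m, ← zpow_add₀ (by norm_num),
      show j + r = m by omega]
  rw [h2, hp, hq, Int.mul_ediv_cancel_left _ two_ne_zero, zpow_natCast, ← hsign,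
    Real.sqrt_mul (show (0 : ℝ) ≤ (2 * n + 1) / (4 * Real.pi) by positivity), harmonicConst, factRoot, hp, hq,
    show (2 * (m : ℤ)).toNat = 2 * m by omega, show (2 * (r : ℤ)).toNat = 2 * r by omega]
  have hA : (dfact (2 * r - 1) * dfact (2 * m - 1) : ℝ) / (dfact (2 * r) * dfact (2 * m)) =
      (2 * r).factorial * (2 * m).factorial * ((n.choose m : ℝ) / (2 ^ n * n.factorial)) ^ 2 := by
    have c1 : (n.choose m : ℝ) * (m.factorial * r.factorial) = n.factorial := by
      rw [← Nat.choose_mul_factorial_mul_factorial (show m ≤ n by omega),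
        show n - m = r by omega]
      push_cast
      ring
    have c2 : (n.choose m : ℝ) / (2 ^ n * n.factorial) =
        1 / (dfact (2 * r) * dfact (2 * m)) := by
      rw [dfact_two_mul, dfact_two_mul, ← c1]
      have : 0 < n.choose m := Nat.choose_pos (by omega)
      push_cast
      rw [show (2 : ℝ) ^ n = 2 ^ m * 2 ^ r by rw [hmr, pow_add]]
      field_simp
    have hr0 : (dfact (2 * r) : ℝ) ≠ 0 := by
      rw [dfact_two_mul]
      positivity
    have hm0 : (dfact (2 * m) : ℝ) ≠ 0 := by
      rw [dfact_two_mul]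
      positivity
    rw [c2, ← dfact_mul_dfact, ← dfact_mul_dfact]
    push_cast
    field_simp
  rw [hA, Real.sqrt_mul (show (0 : ℝ) ≤ (2 * r).factorial * (2 * m).factorial by positivity) (_ ^ 2),
    Real.sqrt_sq (by positivity)]
  ring

end ArcTransform

end

theorem mainTheorem4 (n : ℕ) (k : ℤ) (hk : k ∈ Set.Icc (-(n : ℤ)) n) :
    (∀ (Q : ArcTransform.SO3) (ψ : Set.Icc (0 : ℝ) Real.pi),
      ArcTransform.arcTransform (ArcTransform.sphericalHarmonic n k) (Q, ψ) =
        ∑ j ∈ Finset.Icc (-(n : ℤ)) n,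
          (ArcTransform.normLegendre n j 0 : ℂ) * ArcTransform.wignerD n j k Q *
            (ArcTransform.arcFactor j ψ : ℂ)) ∧
    (∀ j ∈ Set.Icc (-(n : ℤ)) n,
      (Even ((n : ℤ) + j) →
        ArcTransform.normLegendre n j 0 =
          (-1) ^ (((n : ℤ) + j) / 2) *
            Real.sqrt ((2 * n + 1) / (4 * Real.pi) *
              ((ArcTransform.dfact (n - j - 1) * ArcTransform.dfact (n + j - 1)) /
                (ArcTransform.dfact (n - j) * ArcTransform.dfact (n + j))))) ∧
      (Odd ((n : ℤ) + j) → ArcTransform.normLegendre n j 0 = 0)) :=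
  ⟨ArcTransform.arcTransform_sphericalHarmonic n k hk, fun j hj =>
    ⟨ArcTransform.normLegendre_zero_of_even n j hj, ArcTransform.normLegendre_zero_of_odd n j hj⟩⟩
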